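/- **Setting.** Let $\mathcal X\subseteq\mathbb R^d$ be closed, convex and bounded, and let $f,g_1,\dots,g_m:\mathbb R^d\to\mathbb R$ be convex. Assume that some $x\in\mathcal X$ satisfies $g_i(x)\le 0$ for all $i$, and put $$f^*=\min\{f(x):x\in\mathcal X,\ g_i(x)\le 0\ \forall i\},\qquad \bar f=\min_{x\in\mathcal X} f(x),$$ $$v(x,\eta)=\max\{f(x)-\eta,g_1(x),\dots,g_m(x)\},\qquad V(\eta)=\min_{x\in\mathcal X}v(x,\eta),\qquad \eta^*=\min\{\eta:V(\eta)=0\}.$$ An oracle returns subgradients $f'(x)$, $g_i'(x)$. Let $v_\ell(x,z,\eta)$ be $v$ with $f$ and $g_i$ replaced by their linear minorants at $z$, that is by $f(z)+\langle f'(z),x-z\rangle$ and $g_i(z)+\langle g_i'(z),x-z\rangle$. Fix $\alpha>1$, $\beta\in(0,1)$, $\nu\in(1/2,1)$, $\varepsilon>0$ and $\alpha_k=2/(k+1)$. The value $f^*$ is not known to the algorithm. **Gap reduction $\mathcal G(x^0,l,\eta,\theta)$.** Let $y^0=x^0$, $v^{U}_0=v(x^0,\eta)$, $v^L_0=l$,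 $\lambda=\frac12(v_0^L+v_0^U)$, $\bar{\mathcal X}_0=\mathcal X$. For $k=1,2,\dots$: 1. $z^k=(1-\alpha_k)y^{k-1}+\alpha_kx^{k-1}$, $h_k=\min_{x\in\bar{\mathcal X}_{k-1}}v_\ell(x,z^k,\eta)$, $v_k^L=\max\{v_{k-1}^L,\min\{\lambda,h_k\}\}$. If $v_k^L\ge\lambda-\theta(\lambda-v_0^L)$, return $(y^{k-1},v_k^L)$. 2. $x^k$ minimizes $\|x-x^0\|^2$ over $\mathcal X_k^L=\{x\in\bar{\mathcal X}_{k-1}:v_\ell(x,z^k,\eta)\le\lambda\}$. Choose any closed convex $\bar{\mathcal X}_k$ with $\mathcal X_k^L\subseteq\bar{\mathcal X}_k\subseteq\{x\in\mathcal X:\langle x^k-x^0,x-x^k\rangle\ge0\}$. 3. $\tilde y^k=\alpha_kx^k+(1-\alpha_k)y^{k-1}$, $v_k=v(\tilde y^k,\eta)$, $v^U_k=\min\{v_{k-1}^U,v_k\}$, and $y^k$ is any point of $\mathcal X$ with $v(y^k,\eta)=v_k^U$. If $v_k-\lambda\le\theta(v^U_0-\lambda)$, return $(y^k,v_k^L)$.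 **APL $\mathcal A(x^0,\bar l_0,\eta,\theta,\alpha)$.** With $\bar u_s=v(x^s,\eta)$, while $\bar u_s-\bar l_s>\frac{\alpha-1}{\alpha}\bar u_s$ and $\bar u_s>\varepsilon$, set $(x^{s+1},\bar l_{s+1})=\mathcal G(x^s,\bar l_s,\eta,\theta)$. Return the last $(x^s,\bar l_s)$. **Initialization.** Take $\tilde x^0\in\mathcal X$ with $f(\tilde x^0)-\bar f\le\varepsilon$ and set $\eta_0=f(\tilde x^0)$. If $\max_ig_i(\tilde x^0)\le\varepsilon$, stop with Flag True. Otherwise let $(x^0,l_0)=\mathcal A\big(\tilde x^0,\min_{x\in\mathcal X}v_\ell(x,\tilde x^0,\eta_0),\eta_0,\frac12,\alpha\big)$ and $u_0=v(x^0,\eta_0)$. The Flag is True if $u_0\le\varepsilon$ and False otherwise. **Fixed-point loop** (entered when the Flag is False). Start with $t=0$; while $u_t>\varepsilon$, increase $t$ by $1$ and set $$\eta_t=\eta_{t-1}+\beta l_{t-1},\qquad \tilde l_t=\max\Big\{1-\beta,\Big(1+\frac{l_{t-1}-u_{t-2}}{l_{t-2}}\Big)\mathbf 1(t\ge2)\Big\}\,l_{t-1},$$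 $$(x^t,l_t)=\mathcal A(x^{t-1},\tilde l_t,\eta_t,2\nu-1,\alpha),\qquad u_t=v(x^t,\eta_t).$$ **Theorem.** Suppose that the loop is entered. Then, for every execution of the algorithm: 1. For every stage $t>0$ of the loop, $\tilde l_t$ is a positive lower bound of $V(\eta_t)$, and the gap reductions called in the loop are well-posed: in every iteration the minimum $h_k$ exists, and unless the test in step 1 is met, a solution $x^k$, an admissible $\bar{\mathcal X}_k$ and an admissible $y^k$ exist. 2. The number of stages of the loop is bounded. If $u_T\le\varepsilon$ for some $T>0$, then $\eta^*-\eta_T\le\varepsilon/(-V'(\eta^*))$ for every negative subgradient $V'(\eta^*)$ of $V$ at $\eta^*$, and $x^T\in\mathcal X$ is $\varepsilon$-optimal: $f(x^T)-f^*\le\varepsilon$ and $\|[g(x^T)]_+\|_\infty\le\varepsilon$. 3. Suppose in addition that $\rho\in[0,1]$ and that there are functions $M_0,\dots,M_m:\mathbb R^d\times\mathbb R^d\to(0,\infty)$ with $$f(y)-f(x)-\langle f'(x),y-x\rangle\le\tfrac{M_0(y,x)}{1+\rho}\|y-x\|^{1+\rho},\qquad g_i(y)-g_i(x)-\langle g_i'(x),y-x\rangle\le\tfrac{M_i(y,x)}{1+\rho}\|y-x\|^{1+\rho}$$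 for all $x,y\in\mathbb R^d$, $1\le i\le m$. Suppose that $M_i\le\bar M$ on $\mathcal X\times\mathcal X$ for all $i$, that $\mathcal X$ has diameter at most $D$, and that $V(\eta_0)\le B$. Suppose finally that the KKT conditions hold at an optimal solution, with a vector of Lagrange multipliers $y^*\in\mathbb R^m_+$. Then the total number $N$ of gap-reduction iterations begun in the loop, over all calls of $\mathcal G$ (and counted at any moment of the execution), satisfies $$N\le C\,(\|y^*\|_1+1)\big(1+\log(\|y^*\|_1+1)\big)\Big(\frac1\varepsilon\Big)^{\frac{2}{1+3\rho}},$$ where $C$ depends only on $\alpha,\beta,\nu,\rho,\bar M,D,B$. Moreover, for every $\kappa>0$, if $y^*=0$ or $\|y^*\|_1\ge\kappa$, then $$N\le C_\kappa\,(\|y^*\|_1+1)\log(\|y^*\|_1+1)\Big(\frac1\varepsilon\Big)^{\frac{2}{1+3\rho}},$$ where $C_\kappa$ depends only on $\kappa,\alpha,\beta,\nu,\rho,\bar M,D,B$. -/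

import Mathlib

noncomputable section

namespace LevelSet

/-- `s` is a subgradient of the real-valued function `h` at `x`. -/
def IsSubgradient {F : Type*} [NormedAddCommGroup F] [InnerProductSpace ℝ F]
    (h : F → ℝ) (x s : F) : Prop :=
  ∀ y, h x + inner ℝ s (y - x) ≤ h y

/-- Data of the problem `min f x` subject to `x ∈ X` and `g i x ≤ 0`, together with the first-order
oracle: `df x` and `dg i x` are the subgradients of `f` and `g i` used by the algorithm at `x`. -/
structure Problem (d m : ℕ) where
  X : Set (EuclideanSpace ℝ (Fin d))
  f : EuclideanSpace ℝ (Fin d) → ℝ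
  g : Fin m → EuclideanSpace ℝ (Fin d) → ℝ
  df : EuclideanSpace ℝ (Fin d) → EuclideanSpace ℝ (Fin d)
  dg : Fin m → EuclideanSpace ℝ (Fin d) → EuclideanSpace ℝ (Fin d)

namespace Problem

variable {d m : ℕ} (P : Problem d m)

/-- Standing assumptions: a convex problem with a feasible point over a nonempty, closed, convex and
bounded domain, and an oracle that returns subgradients. -/
structure Standing : Prop where
  X_closed : IsClosed P.X
  X_convex : Convex ℝ P.X
  X_bounded : Bornology.IsBounded P.X
  f_convex : ConvexOn ℝ Set.univ P.f
  g_convex : ∀ i, ConvexOn ℝ Set.univ (P.g i)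
  df_subgradient : ∀ x, IsSubgradient P.f x (P.df x)
  dg_subgradient : ∀ i x, IsSubgradient (P.g i) x (P.dg i x)
  feasible : ∃ x ∈ P.X, ∀ i, P.g i x ≤ 0

/-- Hölder-type smoothness of order `ρ` with the modulus functions `M 0` (for the objective) and
`M i.succ` (for the constraint `g i`). -/
structure HolderSmooth (ρ : ℝ)
    (M : Fin (m + 1) → EuclideanSpace ℝ (Fin d) → EuclideanSpace ℝ (Fin d) → ℝ) : Prop where
  pos : ∀ i y x, 0 < M i y x
  objective : ∀ y x,
    P.f y - P.f x - inner ℝ (P.df x) (y - x) ≤ M 0 y x / (1 + ρ) * ‖y - x‖ ^ (1 + ρ)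
  constraint : ∀ i y x,
    P.g i y - P.g i x - inner ℝ (P.dg i x) (y - x) ≤ M i.succ y x / (1 + ρ) * ‖y - x‖ ^ (1 + ρ)

/-- `v(x, η) = max {f x - η, g 1 x, …, g m x}`. -/
def v (x : EuclideanSpace ℝ (Fin d)) (η : ℝ) : ℝ :=
  Finset.univ.sup' Finset.univ_nonempty
    (Fin.cons (P.f x - η) (fun i => P.g i x) : Fin (m + 1) → ℝ)

/-- The maximum of the linear minorants taken at `z`, evaluated at `x`. -/
def vLin (x z : EuclideanSpace ℝ (Fin d)) (η : ℝ) : ℝ :=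
  Finset.univ.sup' Finset.univ_nonempty
    (Fin.cons (P.f z + inner ℝ (P.df z) (x - z) - η)
      (fun i => P.g i z + inner ℝ (P.dg i z) (x - z)) : Fin (m + 1) → ℝ)

/-- The value function `V(η) = min_{x ∈ X} v(x, η)`. -/
def V (η : ℝ) : ℝ := sInf ((fun x => P.v x η) '' P.X)

/-- The optimal value `f*`. -/
def fStar : ℝ := sInf (P.f '' {x | x ∈ P.X ∧ ∀ i, P.g i x ≤ 0})

/-- The minimum of `f` over `X`, the functional constraints being ignored. -/
def fBar : ℝ := sInf (P.f '' P.X)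

/-- The smallest root `η*` of the value function. -/
def etaStar : ℝ := sInf {η | P.V η = 0}

/-- `y` is a vector of Lagrange multipliers: the KKT conditions hold with `y` at some optimal
solution `x`. -/
def IsLagrangeMultiplier (y : Fin m → ℝ) : Prop :=
  (∀ i, 0 ≤ y i) ∧
  ∃ x ∈ P.X, (∀ i, P.g i x ≤ 0) ∧ P.f x = P.fStar ∧ (∀ i, y i * P.g i x = 0) ∧
    ∃ (s₀ : EuclideanSpace ℝ (Fin d)) (s : Fin m → EuclideanSpace ℝ (Fin d))
      (n : EuclideanSpace ℝ (Fin d)),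
      IsSubgradient P.f x s₀ ∧ (∀ i, IsSubgradient (P.g i) x (s i)) ∧
      (∀ w ∈ P.X, 0 ≤ inner ℝ n (x - w)) ∧
      s₀ + ∑ i, y i • s i + n = 0

end Problem

/-! ### Gap reduction -/

/-- Variables of the gap reduction after iteration `k`: the points `x^k`, `y^k`, the bounds `v_k^L`,
`v_k^U` and the localizer `X̄_k`. -/
structure GapState (d : ℕ) where
  x : EuclideanSpace ℝ (Fin d)
  y : EuclideanSpace ℝ (Fin d)
  vL : ℝ
  vU : ℝ
  loc : Set (EuclideanSpace ℝ (Fin d))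

/-- The averaging weights `α_k = 2 / (k + 1)`. -/
def weight (k : ℕ) : ℝ := 2 / ((k : ℝ) + 1)

section Gap

variable {d m : ℕ} (P : Problem d m)

/-- The target level, the midpoint of the initial bounds. -/
def gapLevel (x₀ : EuclideanSpace ℝ (Fin d)) (l η : ℝ) : ℝ := (l + P.v x₀ η) / 2

/-- The state before the first iteration. -/
def gapInit (x₀ : EuclideanSpace ℝ (Fin d)) (l η : ℝ) : GapState d :=
  ⟨x₀, x₀, l, P.v x₀ η, P.X⟩

/-- The point `z^k`, computed from the state `S` left by iteration `k - 1`. -/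
def gapZ (k : ℕ) (S : GapState d) : EuclideanSpace ℝ (Fin d) :=
  (1 - weight k) • S.y + weight k • S.x

/-- `h` is the minimum `h_k` of the linear minorants over the current localizer. -/
def IsGapMin (η : ℝ) (k : ℕ) (S : GapState d) (h : ℝ) : Prop :=
  IsLeast ((fun x => P.vLin x (gapZ k S) η) '' S.loc) h

/-- The updated lower bound `v_k^L`. -/
def gapLower (x₀ : EuclideanSpace ℝ (Fin d)) (l η : ℝ) (S : GapState d) (h : ℝ) : ℝ :=
  max S.vL (min (gapLevel P x₀ l η) h)

/-- The first stopping test, made on the updated lower bound. -/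
def GapBreakLower (x₀ : EuclideanSpace ℝ (Fin d)) (l η θ : ℝ) (S : GapState d) (h : ℝ) : Prop :=
  gapLevel P x₀ l η - θ * (gapLevel P x₀ l η - l) ≤ gapLower P x₀ l η S h

/-- The lower bracket `X_k^L` for the next localizer. -/
def gapXL (x₀ : EuclideanSpace ℝ (Fin d)) (l η : ℝ) (k : ℕ) (S : GapState d) :
    Set (EuclideanSpace ℝ (Fin d)) :=
  {w | w ∈ S.loc ∧ P.vLin w (gapZ k S) η ≤ gapLevel P x₀ l η}

/-- The trial point `ỹ^k`, where `x` is the new point `x^k`. -/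
def gapTrial (k : ℕ) (S : GapState d) (x : EuclideanSpace ℝ (Fin d)) :
    EuclideanSpace ℝ (Fin d) :=
  weight k • x + (1 - weight k) • S.y

/-- The remainder of iteration `k`, after the first stopping test failed, leads from `S` to `S'`:
`x^k` solves the projection subproblem, the localizer is any closed convex set between `X_k^L` and
`X_k^U`, and `y^k` is any point of `X` at which `v(·, η)` equals the new upper bound. -/
structure GapUpdate (x₀ : EuclideanSpace ℝ (Fin d)) (l η : ℝ) (k : ℕ)
    (S : GapState d) (h : ℝ) (S' : GapState d) : Prop where
  vL_eq : S'.vL = gapLower P x₀ l η S h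
  x_mem : S'.x ∈ gapXL P x₀ l η k S
  x_min : ∀ w ∈ gapXL P x₀ l η k S, ‖S'.x - x₀‖ ^ 2 ≤ ‖w - x₀‖ ^ 2
  loc_closed : IsClosed S'.loc
  loc_convex : Convex ℝ S'.loc
  loc_lower : gapXL P x₀ l η k S ⊆ S'.loc
  loc_upper : S'.loc ⊆ {w | w ∈ P.X ∧ 0 ≤ inner ℝ (S'.x - x₀) (w - S'.x)}
  vU_eq : S'.vU = min S.vU (P.v (gapTrial k S S'.x) η)
  y_mem : S'.y ∈ P.X
  y_val : P.v S'.y η = S'.vU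

/-- The second stopping test, made on the trial point of iteration `k`. -/
def GapBreakUpper (x₀ : EuclideanSpace ℝ (Fin d)) (l η θ : ℝ) (k : ℕ) (S S' : GapState d) : Prop :=
  P.v (gapTrial k S S'.x) η - gapLevel P x₀ l η ≤ θ * (P.v x₀ η - gapLevel P x₀ l η)

/-- `GapReach P x₀ l η θ k S`: the gap reduction started with `(x₀, l, η, θ)` can be in state `S`
after `k` iterations, none of which met a stopping test. -/
inductive GapReach (x₀ : EuclideanSpace ℝ (Fin d)) (l η θ : ℝ) : ℕ → GapState d → Prop
  | start : GapReach x₀ l η θ 0 (gapInit P x₀ l η)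
  | step {k : ℕ} {S S' : GapState d} {h : ℝ} :
      GapReach x₀ l η θ k S → IsGapMin P η (k + 1) S h → ¬ GapBreakLower P x₀ l η θ S h →
      GapUpdate P x₀ l η (k + 1) S h S' → ¬ GapBreakUpper P x₀ l η θ (k + 1) S S' →
      GapReach x₀ l η θ (k + 1) S'

/-- `GapReturn P x₀ l η θ k p l'`: the gap reduction started with `(x₀, l, η, θ)` can stop in its
`k`-th iteration and return `(p, l')`. -/
inductive GapReturn (x₀ : EuclideanSpace ℝ (Fin d)) (l η θ : ℝ) :
    ℕ → EuclideanSpace ℝ (Fin d) → ℝ → Prop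
  | lower {k : ℕ} {S : GapState d} {h : ℝ} :
      GapReach P x₀ l η θ k S → IsGapMin P η (k + 1) S h → GapBreakLower P x₀ l η θ S h →
      GapReturn x₀ l η θ (k + 1) S.y (gapLower P x₀ l η S h)
  | upper {k : ℕ} {S S' : GapState d} {h : ℝ} :
      GapReach P x₀ l η θ k S → IsGapMin P η (k + 1) S h → ¬ GapBreakLower P x₀ l η θ S h →
      GapUpdate P x₀ l η (k + 1) S h S' → GapBreakUpper P x₀ l η θ (k + 1) S S' →
      GapReturn x₀ l η θ (k + 1) S'.y S'.vL

/-- Iteration `k + 1`, started from the state `S` reached after `k` iterations, can be carried out: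
the minimum `h` exists, and unless the first stopping test is met the projection subproblem has a
solution and an admissible localizer and an admissible `y` exist. -/
def GapWellPosed (x₀ : EuclideanSpace ℝ (Fin d)) (l η θ : ℝ) (k : ℕ) (S : GapState d) : Prop :=
  (∃ h, IsGapMin P η (k + 1) S h) ∧
  ∀ h, IsGapMin P η (k + 1) S h → ¬ GapBreakLower P x₀ l η θ S h →
    ∃ S', GapUpdate P x₀ l η (k + 1) S h S'

/-! ### The accelerated prox-level method (APL) -/

/-- The loop condition of APL at the point `x` with the lower bound `l`. -/
def AplGuard (η α ε : ℝ) (x : EuclideanSpace ℝ (Fin d)) (l : ℝ) : Prop :=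
  (α - 1) / α * P.v x η < P.v x η - l ∧ ε < P.v x η

/-- `AplReach P η θ α ε x₀ l₀ n x l`: APL started with `(x₀, l₀)` can arrive at `(x, l)` between two
calls of the gap reduction, after `n` gap-reduction iterations over all its calls. -/
inductive AplReach (η θ α ε : ℝ) (x₀ : EuclideanSpace ℝ (Fin d)) (l₀ : ℝ) :
    ℕ → EuclideanSpace ℝ (Fin d) → ℝ → Prop
  | start : AplReach η θ α ε x₀ l₀ 0 x₀ l₀
  | call {n k : ℕ} {x p : EuclideanSpace ℝ (Fin d)} {l l' : ℝ} :
      AplReach η θ α ε x₀ l₀ n x l → AplGuard P η α ε x l → GapReturn P x l η θ k p l' →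
      AplReach η θ α ε x₀ l₀ (n + k) p l'

/-- APL started with `(x₀, l₀)` can return `(x, l)` after `n` gap-reduction iterations. -/
def AplReturn (η θ α ε : ℝ) (x₀ : EuclideanSpace ℝ (Fin d)) (l₀ : ℝ)
    (n : ℕ) (x : EuclideanSpace ℝ (Fin d)) (l : ℝ) : Prop :=
  AplReach P η θ α ε x₀ l₀ n x l ∧ ¬ AplGuard P η α ε x l

/-! ### The initialization phase and the fixed-point loop -/

/-- The initialization phase can return `(x₀, η₀, l₀, False)`, so that root finding is required. -/
def InitPhase (α ε : ℝ) (x₀ : EuclideanSpace ℝ (Fin d)) (η₀ l₀ : ℝ) : Prop :=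
  ∃ xt ∈ P.X, P.f xt - P.fBar ≤ ε ∧ η₀ = P.f xt ∧ (¬ ∀ i, P.g i xt ≤ ε) ∧
    ∃ l, IsLeast ((fun x => P.vLin x xt η₀) '' P.X) l ∧
      (∃ n, AplReturn P η₀ (1 / 2) α ε xt l n x₀ l₀) ∧ ε < P.v x₀ η₀

/-- Variables of the fixed-point loop after stage `t`: `x^t`, `η_t`, `l_t`, `u_t`, the bounds
`l_{t-1}`, `u_{t-1}` (unused if `t = 0`), and the number `iters` of gap-reduction iterations made in
the stages `1, …, t`. -/
structure LoopState (d : ℕ) where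
  t : ℕ
  x : EuclideanSpace ℝ (Fin d)
  η : ℝ
  l : ℝ
  u : ℝ
  lPrev : ℝ
  uPrev : ℝ
  iters : ℕ

/-- The level `η_{t+1} = η_t + β l_t`. -/
def LoopState.nextEta (β : ℝ) (s : LoopState d) : ℝ := s.η + β * s.l

/-- The initial lower bound `l̃_{t+1}` of stage `t + 1`. -/
def LoopState.nextLower (β : ℝ) (s : LoopState d) : ℝ :=
  max (1 - β) (if 2 ≤ s.t + 1 then 1 + (s.l - s.uPrev) / s.lPrev else 0) * s.l

/-- The states that the loop, entered with `(x₀, η₀, l₀)`, can be in after a completed stage. -/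
inductive LoopReach (α β ν ε : ℝ) (x₀ : EuclideanSpace ℝ (Fin d)) (η₀ l₀ : ℝ) :
    LoopState d → Prop
  | start : LoopReach α β ν ε x₀ η₀ l₀ ⟨0, x₀, η₀, l₀, P.v x₀ η₀, 0, 0, 0⟩
  | stage {s : LoopState d} {n : ℕ} {x : EuclideanSpace ℝ (Fin d)} {l : ℝ} :
      LoopReach α β ν ε x₀ η₀ l₀ s → ε < s.u →
      AplReturn P (s.nextEta β) (2 * ν - 1) α ε s.x (s.nextLower β) n x l →
      LoopReach α β ν ε x₀ η₀ l₀
        ⟨s.t + 1, x, s.nextEta β, l, P.v x (s.nextEta β), s.l, s.u, s.iters + n⟩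

/-- A call of the gap reduction with input `(x, l)` can be made in the stage that follows `s`, after
`n` gap-reduction iterations of that stage. -/
def LoopCall (α β ν ε : ℝ) (s : LoopState d) (n : ℕ) (x : EuclideanSpace ℝ (Fin d)) (l : ℝ) :
    Prop :=
  ε < s.u ∧
  AplReach P (s.nextEta β) (2 * ν - 1) α ε s.x (s.nextLower β) n x l ∧
  AplGuard P (s.nextEta β) α ε x l

/-- `LoopIters P α β ν ε x₀ η₀ l₀ N`: some (complete or partial) execution of the loop has begun
exactly `N` gap-reduction iterations since the loop was entered; a call that is still running is
included. -/
inductive LoopIters (α β ν ε : ℝ) (x₀ : EuclideanSpace ℝ (Fin d)) (η₀ l₀ : ℝ) : ℕ → Prop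
  | between {s : LoopState d} :
      LoopReach P α β ν ε x₀ η₀ l₀ s → LoopIters α β ν ε x₀ η₀ l₀ s.iters
  | running {s : LoopState d} {n k : ℕ} {x : EuclideanSpace ℝ (Fin d)} {l : ℝ} {S : GapState d} :
      LoopReach P α β ν ε x₀ η₀ l₀ s → LoopCall P α β ν ε s n x l →
      GapReach P x l (s.nextEta β) (2 * ν - 1) k S →
      LoopIters α β ν ε x₀ η₀ l₀ (s.iters + n + (k + 1))

end Gap

end LevelSet

end

noncomputable section

namespace LevelSet

/-! ### The value function: convexity, slope, roots, and the Lagrangian error bound. -/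

namespace Problem

variable {d m : ℕ} {P : Problem d m}

/-! The value function V is convex and nonincreasing with slope at least -1, and it vanishes at f*.
If 0 < l ≤ V(η), then η < f*, and a step of length β l lowers V by at most β l, so (1 - β) l is
still a positive lower bound. The line through an upper bound at the previous level and a lower
bound at the current one gives a second lower bound (`extrapolate_V`). APL stops with u ≤ α l unless
u ≤ ε, so every step is longer than β ε / α. The levels stay below f*, hence the stages are finitely
many, and v(x, η) ≤ ε at a level η < f* gives ε-optimality.

For the complexity put p = 2 / (1 + 3ρ). A gap reduction that starts from the gap Δ takes O(Δ^(-p))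
iterations (`GapReach.iters_le`), and the APL guard keeps Δ above a fixed fraction of V(η). Each
call contracts the gap by ν, while a stage starts with a gap O(V(η)). Hence a stage makes at most K
calls, with K depending only on α, β, ν, and costs O(V(η)^(-p)).

The KKT conditions give f* - η ≤ (‖y*‖₁ + 1) V(η). With convexity, each stage multiplies V by at
most 1 - q, where q = β / (α (‖y*‖₁ + 1)) (`LoopInvariant.V_nextEta_le`). The stage costs are thus
bounded by geometrically growing terms, whose sum is at most 2/q times the last one
(`accumulate_rpow_inv`), and V ≥ (1 - β) ε / α at every level used. The resulting bound is linear in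
‖y*‖₁ + 1; the logarithms in the theorem are slack. -/

theorem v_le_iff {x : EuclideanSpace ℝ (Fin d)} {η c : ℝ} :
    P.v x η ≤ c ↔ P.f x - η ≤ c ∧ ∀ i, P.g i x ≤ c := by
  simp [v, Finset.sup'_le_iff, Fin.forall_fin_succ]

theorem vLin_le_iff {x z : EuclideanSpace ℝ (Fin d)} {η c : ℝ} :
    P.vLin x z η ≤ c ↔ P.f z + inner ℝ (P.df z) (x - z) - η ≤ c ∧
      ∀ i, P.g i z + inner ℝ (P.dg i z) (x - z) ≤ c := by
  simp [vLin, Finset.sup'_le_iff, Fin.forall_fin_succ]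

theorem f_sub_le_v (x : EuclideanSpace ℝ (Fin d)) (η : ℝ) : P.f x - η ≤ P.v x η :=
  (v_le_iff.1 le_rfl).1

theorem g_le_v (x : EuclideanSpace ℝ (Fin d)) (η : ℝ) (i : Fin m) : P.g i x ≤ P.v x η :=
  (v_le_iff.1 le_rfl).2 i

theorem v_antitone (x : EuclideanSpace ℝ (Fin d)) : Antitone (P.v x) := fun η η' h =>
  v_le_iff.2 ⟨by linarith [P.f_sub_le_v x η], P.g_le_v x η⟩

theorem v_le_add (x : EuclideanSpace ℝ (Fin d)) {η η' : ℝ} (h : η ≤ η') :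
    P.v x η ≤ P.v x η' + (η' - η) :=
  v_le_iff.2 ⟨by linarith [P.f_sub_le_v x η'], fun i => by linarith [P.g_le_v x η' i]⟩

theorem continuous_vLin (z : EuclideanSpace ℝ (Fin d)) (η : ℝ) :
    Continuous fun x => P.vLin x z η := by
  unfold vLin
  refine Continuous.finset_sup'_apply _ fun i _ => ?_
  refine Fin.cases ?_ (fun j => ?_) i
  · simp only [Fin.cons_zero]; fun_prop
  · simp only [Fin.cons_succ]; fun_prop

theorem convexOn_vLin (z : EuclideanSpace ℝ (Fin d)) (η : ℝ) :
    ConvexOn ℝ Set.univ fun x => P.vLin x z η := by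
  refine ⟨convex_univ, fun x _ y _ a b ha hb hab => ?_⟩
  have hx := (vLin_le_iff (P := P) (x := x) (z := z) (η := η)).1 le_rfl
  have hy := (vLin_le_iff (P := P) (x := y) (z := z) (η := η)).1 le_rfl
  have key : ∀ s : EuclideanSpace ℝ (Fin d), inner ℝ s (a • x + b • y - z)
      = a * inner ℝ s (x - z) + b * inner ℝ s (y - z) := fun s => by
    simp only [inner_sub_right, inner_add_right, inner_smul_right]
    linear_combination (inner ℝ s z) * hab
  simp only [smul_eq_mul]
  refine vLin_le_iff.2 ⟨?_, fun i => ?_⟩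
  · rw [key]
    have := add_le_add (mul_le_mul_of_nonneg_left hx.1 ha) (mul_le_mul_of_nonneg_left hy.1 hb)
    refine le_trans (le_of_eq ?_) this
    linear_combination -(P.f z - η) * hab
  · rw [key]
    have := add_le_add (mul_le_mul_of_nonneg_left (hx.2 i) ha)
      (mul_le_mul_of_nonneg_left (hy.2 i) hb)
    refine le_trans (le_of_eq ?_) this
    linear_combination -(P.g i z) * hab

/-- The KKT point minimizes the Lagrangian over X: add the subgradient inequalities weighted by the
multipliers. Complementary slackness removes the constraint values, and the normal vector
contributes with the right sign. -/
theorem IsLagrangeMultiplier.fStar_le {y : Fin m → ℝ} (hy : P.IsLagrangeMultiplier y)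
    {x : EuclideanSpace ℝ (Fin d)} (hx : x ∈ P.X) : P.fStar ≤ P.f x + ∑ i, y i * P.g i x := by
  obtain ⟨hy0, xs, -, -, hfs, hcs, s₀, s, n, hs₀, hs, hn, hsum⟩ := hy
  have h1 : ∑ i, y i * (P.g i xs + inner ℝ (s i) (x - xs)) ≤ ∑ i, y i * P.g i x :=
    Finset.sum_le_sum fun i _ => mul_le_mul_of_nonneg_left (hs i x) (hy0 i)
  have h2 := congrArg (fun w => inner ℝ w (x - xs)) hsum
  simp only [inner_add_left, sum_inner, inner_smul_left, inner_zero_left, conj_trivial] at h2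
  simp only [mul_add, Finset.sum_add_distrib, hcs, Finset.sum_const_zero] at h1
  have h3 := hn x hx
  have h4 : inner ℝ n (xs - x) = - inner ℝ n (x - xs) := by
    rw [← inner_neg_right, neg_sub]
  linarith [hs₀ x]

namespace Standing

variable (hP : P.Standing)
include hP

theorem X_nonempty : P.X.Nonempty := let ⟨x, hx, _⟩ := hP.feasible; ⟨x, hx⟩

theorem X_compact : IsCompact P.X := Metric.isCompact_of_isClosed_isBounded hP.X_closed hP.X_bounded

theorem vLin_le_v (x z : EuclideanSpace ℝ (Fin d)) (η : ℝ) :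
    P.vLin x z η ≤ P.v x η :=
  vLin_le_iff.2 ⟨by linarith [P.f_sub_le_v x η, hP.df_subgradient z x],
    fun i => (hP.dg_subgradient i z x).trans (P.g_le_v x η i)⟩

theorem exists_le_f : ∃ c, ∀ x ∈ P.X, c ≤ P.f x := by
  obtain ⟨c, hc⟩ := (hP.X_compact.image (f := fun x => P.f 0 + inner ℝ (P.df 0) (x - 0))
    (by fun_prop)).bddBelow
  exact ⟨c, fun x hx => (hc ⟨x, hx, rfl⟩).trans (hP.df_subgradient 0 x)⟩

theorem bddBelow_v (η : ℝ) : BddBelow ((fun x => P.v x η) '' P.X) := by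
  obtain ⟨c, hc⟩ := hP.exists_le_f
  refine ⟨c - η, ?_⟩
  rintro _ ⟨x, hx, rfl⟩
  exact le_trans (by linarith [hc x hx]) (P.f_sub_le_v x η)

theorem V_le {x : EuclideanSpace ℝ (Fin d)} (hx : x ∈ P.X) (η : ℝ) : P.V η ≤ P.v x η :=
  csInf_le (hP.bddBelow_v η) ⟨x, hx, rfl⟩

theorem le_V_iff {η c : ℝ} : c ≤ P.V η ↔ ∀ x ∈ P.X, c ≤ P.v x η := by
  refine ⟨fun h x hx => h.trans (hP.V_le hx η), fun h => ?_⟩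
  refine le_csInf (hP.X_nonempty.image _) ?_
  rintro _ ⟨x, hx, rfl⟩
  exact h x hx

theorem exists_v_lt {η c : ℝ} (h : P.V η < c) : ∃ x ∈ P.X, P.v x η < c := by
  by_contra! H
  exact h.not_ge (hP.le_V_iff.2 H)

theorem V_antitone : Antitone P.V := fun _ η' h =>
  hP.le_V_iff.2 fun _ hx => (hP.V_le hx η').trans (P.v_antitone _ h)

theorem V_le_add {η η' : ℝ} (h : η ≤ η') : P.V η ≤ P.V η' + (η' - η) := by
  have : P.V η - (η' - η) ≤ P.V η' :=
    hP.le_V_iff.2 fun x hx => by linarith [P.v_le_add x h, hP.V_le hx η]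
  linarith

/-- Partial minimization of a jointly convex function. Near-minimizers with slack δ suffice, so
attainment of the minimum is not needed. -/
theorem V_convexOn : ConvexOn ℝ Set.univ P.V := by
  refine ⟨convex_univ, fun η₁ _ η₂ _ a b ha hb hab => ?_⟩
  refine le_of_forall_pos_le_add fun δ hδ => ?_
  obtain ⟨x₁, hx₁, h₁⟩ := hP.exists_v_lt (lt_add_of_pos_right (P.V η₁) hδ)
  obtain ⟨x₂, hx₂, h₂⟩ := hP.exists_v_lt (lt_add_of_pos_right (P.V η₂) hδ)
  refine (hP.V_le (hP.X_convex hx₁ hx₂ ha hb hab) _).trans ?_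
  simp only [smul_eq_mul]
  have hδ' : δ = a * δ + b * δ := by rw [← add_mul, hab, one_mul]
  have e₁ := v_le_iff.1 h₁.le
  have e₂ := v_le_iff.1 h₂.le
  refine v_le_iff.2 ⟨?_, fun i => ?_⟩
  · have := hP.f_convex.2 (Set.mem_univ x₁) (Set.mem_univ x₂) ha hb hab
    simp only [smul_eq_mul] at this
    linarith [mul_le_mul_of_nonneg_left e₁.1 ha, mul_le_mul_of_nonneg_left e₂.1 hb]
  · have := (hP.g_convex i).2 (Set.mem_univ x₁) (Set.mem_univ x₂) ha hb hab
    simp only [smul_eq_mul] at this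
    linarith [mul_le_mul_of_nonneg_left (e₁.2 i) ha, mul_le_mul_of_nonneg_left (e₂.2 i) hb]

/-- Extrapolation of the value function beyond two points where it is estimated. -/
theorem extrapolate_V {η a b l u : ℝ} (ha : 0 < a) (hb : 0 < b) (hu : P.V η ≤ u)
    (hl : l ≤ P.V (η + a)) : l + (l - u) / a * b ≤ P.V (η + a + b) := by
  have hab : 0 < a + b := by positivity
  have := hP.V_convexOn.2 (Set.mem_univ η) (Set.mem_univ (η + a + b))
    (show 0 ≤ b / (a + b) by positivity) (show 0 ≤ a / (a + b) by positivity)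
    (by field_simp; ring)
  have e : (b / (a + b)) • η + (a / (a + b)) • (η + a + b) = η + a := by
    simp only [smul_eq_mul]; field_simp; ring
  rw [e] at this
  simp only [smul_eq_mul] at this
  have h2 : (a + b) * P.V (η + a) ≤ b * P.V η + a * P.V (η + a + b) := by
    calc _ ≤ (a + b) * (b / (a + b) * P.V η + a / (a + b) * P.V (η + a + b)) := by gcongr
      _ = _ := by field_simp
  have h3 : a * (l + (l - u) / a * b) ≤ a * P.V (η + a + b) := by
    have : a * (l + (l - u) / a * b) = (a + b) * l - b * u := by field_simp; ring
    rw [this]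
    linarith [mul_le_mul_of_nonneg_left hl hab.le, mul_le_mul_of_nonneg_left hu hb.le]
  exact le_of_mul_le_mul_left h3 ha

theorem V_fStar_le : P.V P.fStar ≤ 0 := by
  refine le_of_forall_pos_le_add fun δ hδ => ?_
  obtain ⟨x₀, hx₀, hg₀⟩ := hP.feasible
  have hne : (P.f '' {x | x ∈ P.X ∧ ∀ i, P.g i x ≤ 0}).Nonempty := ⟨_, x₀, ⟨hx₀, hg₀⟩, rfl⟩
  obtain ⟨_, ⟨x, ⟨hx, hg⟩, rfl⟩, h⟩ :=
    exists_lt_of_csInf_lt hne (lt_add_of_pos_right P.fStar hδ)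
  exact (hP.V_le hx _).trans (v_le_iff.2 ⟨by linarith, fun i => by linarith [hg i]⟩)

theorem lt_fStar {η : ℝ} (h : 0 < P.V η) : η < P.fStar := by
  by_contra! H
  linarith [hP.V_antitone H, hP.V_fStar_le]

/-- If V(f*) were negative, some point would be feasible with objective value below f*. -/
theorem V_fStar : P.V P.fStar = 0 := by
  refine le_antisymm hP.V_fStar_le (not_lt.1 fun H => ?_)
  obtain ⟨x, hx, h⟩ := hP.exists_v_lt H
  have h2 := (v_le_iff.1 h.le).2
  obtain ⟨c, hc⟩ := hP.exists_le_f
  have : P.fStar ≤ P.f x := by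
    refine csInf_le ⟨c, ?_⟩ ⟨x, ⟨hx, h2⟩, rfl⟩
    rintro _ ⟨y, ⟨hy, _⟩, rfl⟩
    exact hc y hy
  linarith [P.f_sub_le_v x P.fStar]

theorem continuous_V : Continuous P.V := by
  refine LipschitzWith.continuous (K := 1) (LipschitzWith.of_le_add_mul 1 fun η η' => ?_)
  rw [NNReal.coe_one, one_mul, Real.dist_eq]
  rcases le_total η η' with h | h
  · linarith [hP.V_le_add h, neg_abs_le (η - η')]
  · linarith [hP.V_antitone h, abs_nonneg (η - η')]

theorem V_etaStar : P.V P.etaStar = 0 := by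
  have hc : IsClosed {η | P.V η = 0} := isClosed_eq hP.continuous_V continuous_const
  refine hc.csInf_mem ⟨_, hP.V_fStar⟩ ?_
  obtain ⟨c, hf⟩ := hP.exists_le_f
  refine ⟨c, fun η (hη : P.V η = 0) => ?_⟩
  have : c - η ≤ P.V η :=
    hP.le_V_iff.2 fun x hx => le_trans (by linarith [hf x hx]) (P.f_sub_le_v x η)
  linarith

/-- In the Lagrangian bound, f(x) is at most η + v(x, η) and each g_i(x) at most v(x, η); then
minimize over x. -/
theorem fStar_sub_le {y : Fin m → ℝ} (hy : P.IsLagrangeMultiplier y) (η : ℝ) :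
    P.fStar - η ≤ (∑ i, |y i| + 1) * P.V η := by
  have hY : 0 < ∑ i, |y i| + 1 := by positivity
  rw [← div_le_iff₀' hY]
  refine hP.le_V_iff.2 fun x hx => ?_
  rw [div_le_iff₀' hY]
  have h1 := hy.fStar_le hx
  have h2 : ∑ i, y i * P.g i x ≤ ∑ i, |y i| * P.v x η :=
    Finset.sum_le_sum fun i _ => by
      rw [abs_of_nonneg (hy.1 i)]
      exact mul_le_mul_of_nonneg_left (P.g_le_v x η i) (hy.1 i)
  rw [← Finset.sum_mul] at h2
  linarith [P.f_sub_le_v x η]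

end Standing

theorem HolderSmooth.v_le {ρ : ℝ}
    {M : Fin (m + 1) → EuclideanSpace ℝ (Fin d) → EuclideanSpace ℝ (Fin d) → ℝ}
    (hM : P.HolderSmooth ρ M) (hρ : 0 ≤ ρ) {Mbar : ℝ} {y z : EuclideanSpace ℝ (Fin d)}
    (hb : ∀ i, M i y z ≤ Mbar) (η : ℝ) :
    P.v y η ≤ P.vLin y z η + Mbar / (1 + ρ) * ‖y - z‖ ^ (1 + ρ) := by
  have hle : ∀ i, M i y z / (1 + ρ) * ‖y - z‖ ^ (1 + ρ) ≤ Mbar / (1 + ρ) * ‖y - z‖ ^ (1 + ρ) :=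
    fun i => by gcongr; exact hb i
  have hl := (vLin_le_iff (P := P) (x := y) (z := z) (η := η)).1 le_rfl
  exact v_le_iff.2 ⟨by linarith [hM.objective y z, hle 0],
    fun i => by linarith [hM.constraint i y z, hle i.succ, hl.2 i]⟩

end Problem

/-! ### The gap reduction: invariants, well-posedness, contraction of the gap. -/

variable {d m : ℕ} {P : Problem d m}

theorem weight_succ_nonneg (k : ℕ) : 0 ≤ weight (k + 1) := by
  unfold weight; positivity

theorem weight_succ_le_one (k : ℕ) : weight (k + 1) ≤ 1 := by
  unfold weight
  rw [div_le_one (by positivity)]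
  push_cast
  linarith [(Nat.cast_nonneg k : (0 : ℝ) ≤ k)]

/-- Properties of the states of a gap reduction whose input `l` is a lower bound of `V η`. -/
structure GapInvariant (P : Problem d m) (x₀ : EuclideanSpace ℝ (Fin d)) (l η : ℝ)
    (S : GapState d) : Prop where
  x_mem : S.x ∈ S.loc
  y_mem : S.y ∈ P.X
  y_val : P.v S.y η = S.vU
  vU_le : S.vU ≤ P.v x₀ η
  le_vL : l ≤ S.vL
  vL_le : S.vL ≤ P.V η
  loc_closed : IsClosed S.loc
  loc_convex : Convex ℝ S.loc
  loc_subset : S.loc ⊆ P.X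
  level_le : ∀ w ∈ P.X, w ∉ S.loc → gapLevel P x₀ l η ≤ P.v w η
  inner_nonneg : ∀ w ∈ S.loc, 0 ≤ inner ℝ (S.x - x₀) (w - S.x)

/-- The minimum h bounds v only on the localizer. Discarded points have v at least the level, so h
truncated at the level is valid on all of X. -/
theorem gapLower_le_V (hP : P.Standing) {x₀ : EuclideanSpace ℝ (Fin d)} {l η h : ℝ} {k : ℕ}
    {S : GapState d} (hS : GapInvariant P x₀ l η S) (hh : IsGapMin P η k S h) :
    gapLower P x₀ l η S h ≤ P.V η := by
  refine max_le hS.vL_le (hP.le_V_iff.2 fun w hw => ?_)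
  by_cases hwl : w ∈ S.loc
  · exact (min_le_right _ _).trans ((hh.2 ⟨w, hwl, rfl⟩).trans (hP.vLin_le_v w _ η))
  · exact (min_le_left _ _).trans (hS.level_le w hw hwl)

theorem gapTrial_mem (hP : P.Standing) {k : ℕ} {S : GapState d} {x : EuclideanSpace ℝ (Fin d)}
    (hy : S.y ∈ P.X) (hx : x ∈ P.X) : gapTrial (k + 1) S x ∈ P.X :=
  hP.X_convex hx hy (weight_succ_nonneg k) (sub_nonneg.2 (weight_succ_le_one k)) (by ring)

theorem GapInvariant.start (hP : P.Standing) {x₀ : EuclideanSpace ℝ (Fin d)} {l η : ℝ}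
    (hx₀ : x₀ ∈ P.X) (hl : l ≤ P.V η) : GapInvariant P x₀ l η (gapInit P x₀ l η) where
  x_mem := hx₀
  y_mem := hx₀
  y_val := rfl
  vU_le := le_rfl
  le_vL := le_rfl
  vL_le := hl
  loc_closed := hP.X_closed
  loc_convex := hP.X_convex
  loc_subset := subset_rfl
  level_le _ hw hn := absurd hw hn
  inner_nonneg w _ := by simp [gapInit]

theorem GapInvariant.update (hP : P.Standing) {x₀ : EuclideanSpace ℝ (Fin d)} {l η h : ℝ} {k : ℕ}
    {S S' : GapState d} (hS : GapInvariant P x₀ l η S) (hh : IsGapMin P η k S h)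
    (hu : GapUpdate P x₀ l η k S h S') : GapInvariant P x₀ l η S' where
  x_mem := hu.loc_lower hu.x_mem
  y_mem := hu.y_mem
  y_val := hu.y_val
  vU_le := hu.vU_eq ▸ (min_le_left _ _).trans hS.vU_le
  le_vL := hu.vL_eq ▸ hS.le_vL.trans (le_max_left _ _)
  vL_le := hu.vL_eq ▸ gapLower_le_V hP hS hh
  loc_closed := hu.loc_closed
  loc_convex := hu.loc_convex
  loc_subset _ hw := (hu.loc_upper hw).1
  level_le w hw hn := by
    by_cases hwl : w ∈ S.loc
    -- A point lost in this iteration violates the level cut, so already a minorant of v exceeds the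
    -- level there.
    · have : ¬ P.vLin w (gapZ k S) η ≤ gapLevel P x₀ l η := fun hle =>
        hn (hu.loc_lower ⟨hwl, hle⟩)
      exact (not_le.1 this).le.trans (hP.vLin_le_v _ _ _)
    · exact hS.level_le w hw hwl
  inner_nonneg _ hw := (hu.loc_upper hw).2

theorem GapReach.invariant (hP : P.Standing) {x₀ : EuclideanSpace ℝ (Fin d)} {l η θ : ℝ} {k : ℕ}
    {S : GapState d} (hx₀ : x₀ ∈ P.X) (hl : l ≤ P.V η) (hr : GapReach P x₀ l η θ k S) :
    GapInvariant P x₀ l η S := by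
  induction hr with
  | start => exact .start hP hx₀ hl
  | step _ hh _ hu _ ih => exact ih.update hP hh hu

/-- A minimizer of the distance to `u` over a compact convex set, with its variational inequality. -/
theorem exists_projection {F : Type*} [NormedAddCommGroup F] [InnerProductSpace ℝ F] {K : Set F}
    (hne : K.Nonempty) (hc : IsComplete K) (hK : Convex ℝ K) (u : F) :
    ∃ x ∈ K, (∀ w ∈ K, ‖x - u‖ ^ 2 ≤ ‖w - u‖ ^ 2) ∧ ∀ w ∈ K, 0 ≤ inner ℝ (x - u) (w - x) := by
  obtain ⟨x, hx, hmin⟩ := exists_norm_eq_iInf_of_complete_convex hne hc hK u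
  refine ⟨x, hx, fun w hw => ?_, fun w hw => ?_⟩
  · rw [norm_sub_rev x, norm_sub_rev w, hmin]
    have hle : ⨅ w : K, ‖u - w‖ ≤ ‖u - w‖ :=
      ciInf_le ⟨0, by rintro _ ⟨_, rfl⟩; exact norm_nonneg _⟩ (⟨w, hw⟩ : K)
    have h0 : 0 ≤ ⨅ w : K, ‖u - w‖ := Real.iInf_nonneg fun _ => norm_nonneg _
    gcongr
  · have := (norm_eq_iInf_iff_real_inner_le_zero hK hx).1 hmin w hw
    rw [← neg_sub u x, inner_neg_left]
    linarith

theorem GapInvariant.wellPosed (hP : P.Standing) {x₀ : EuclideanSpace ℝ (Fin d)} {l η θ : ℝ}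
    {k : ℕ} {S : GapState d} (hθ : 0 ≤ θ) (hl : l ≤ P.v x₀ η) (hS : GapInvariant P x₀ l η S) :
    GapWellPosed P x₀ l η θ k S := by
  have hcomp : IsCompact S.loc := hP.X_compact.of_isClosed_subset hS.loc_closed hS.loc_subset
  have hcont := P.continuous_vLin (gapZ (k + 1) S) η
  refine ⟨(hcomp.image hcont).exists_isLeast (Set.Nonempty.image _ ⟨_, hS.x_mem⟩), fun h hh hb => ?_⟩
  -- A failed lower test forces h below the level, so the minimizer of the minorant lies in X_k^L.
  -- That set is therefore nonempty, and it serves as its own admissible localizer.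
  have hlt : h < gapLevel P x₀ l η := by
    have h1 : l ≤ gapLevel P x₀ l η := by unfold gapLevel; linarith
    have h2 := not_le.1 hb
    have h3 : min (gapLevel P x₀ l η) h < gapLevel P x₀ l η :=
      lt_of_le_of_lt (le_max_right _ _) (h2.trans_le (by nlinarith))
    simpa using h3
  have hne : (gapXL P x₀ l η (k + 1) S).Nonempty := by
    obtain ⟨w, hw, rfl⟩ := hh.1
    exact ⟨w, hw, hlt.le⟩
  have hclosed : IsClosed (gapXL P x₀ l η (k + 1) S) :=
    hS.loc_closed.inter (isClosed_le hcont continuous_const)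
  have hconv : Convex ℝ (gapXL P x₀ l η (k + 1) S) := by
    have := (P.convexOn_vLin (gapZ (k + 1) S) η).convex_le (gapLevel P x₀ l η)
    simpa [gapXL, Set.ofPred_and] using hS.loc_convex.inter this
  obtain ⟨x, hx, hmin, hvar⟩ := exists_projection hne hclosed.isComplete hconv x₀
  have hy : ∃ y ∈ P.X, P.v y η = min S.vU (P.v (gapTrial (k + 1) S x) η) := by
    rcases min_cases S.vU (P.v (gapTrial (k + 1) S x) η) with ⟨e, -⟩ | ⟨e, -⟩
    · exact ⟨_, hS.y_mem, by rw [e, hS.y_val]⟩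
    · exact ⟨_, gapTrial_mem hP hS.y_mem (hS.loc_subset hx.1), e.symm⟩
  obtain ⟨y, hyX, hyv⟩ := hy
  exact ⟨⟨x, y, gapLower P x₀ l η S h, min S.vU (P.v (gapTrial (k + 1) S x) η),
    gapXL P x₀ l η (k + 1) S⟩, rfl, hx, hmin, hclosed, hconv, subset_rfl,
    fun w hw => ⟨hS.loc_subset hw.1, hvar w hw⟩, rfl, hyX, hyv⟩

/-- The level is the midpoint of the initial bounds. At either exit one half of the gap shrinks by θ
and the other does not grow, hence the factor (1 + θ) / 2. -/
theorem GapReturn.spec (hP : P.Standing) {x₀ p : EuclideanSpace ℝ (Fin d)} {l l' η θ : ℝ} {k : ℕ}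
    (hx₀ : x₀ ∈ P.X) (hl : l ≤ P.V η) (hr : GapReturn P x₀ l η θ k p l') :
    p ∈ P.X ∧ l ≤ l' ∧ l' ≤ P.V η ∧ P.v p η ≤ P.v x₀ η ∧
      P.v p η - l' ≤ (1 + θ) / 2 * (P.v x₀ η - l) := by
  cases hr with
  | lower hS hh hb =>
    have hS := hS.invariant hP hx₀ hl
    refine ⟨hS.y_mem, hS.le_vL.trans (le_max_left _ _), gapLower_le_V hP hS hh,
      hS.y_val.trans_le hS.vU_le, ?_⟩
    have h1 := hS.y_val.trans_le hS.vU_le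
    unfold GapBreakLower at hb
    have : gapLevel P x₀ l η = (l + P.v x₀ η) / 2 := rfl
    rw [this] at hb
    linarith
  | @upper k S S' h hS hh _ hu hb =>
    have hS := (hS.invariant hP hx₀ hl).update hP hh hu
    have h1 := hS.y_val.trans_le hS.vU_le
    refine ⟨hS.y_mem, hS.le_vL, hS.vL_le, h1, ?_⟩
    have h2 : P.v S'.y η ≤ P.v (gapTrial (k + 1) S S'.x) η := by
      rw [hS.y_val, hu.vU_eq]; exact min_le_right _ _
    have h3 := hS.le_vL
    unfold GapBreakUpper at hb
    have : gapLevel P x₀ l η = (l + P.v x₀ η) / 2 := rfl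
    rw [this] at hb
    linarith

/-! ### APL and the fixed-point loop: lower bounds, termination, accuracy. -/

theorem AplReach.spec (hP : P.Standing) {η θ α ε : ℝ} {x₀ x : EuclideanSpace ℝ (Fin d)}
    {l₀ l : ℝ} {n : ℕ} (hx₀ : x₀ ∈ P.X) (hl₀ : l₀ ≤ P.V η)
    (hr : AplReach P η θ α ε x₀ l₀ n x l) :
    x ∈ P.X ∧ l₀ ≤ l ∧ l ≤ P.V η ∧ P.v x η ≤ P.v x₀ η := by
  induction hr with
  | start => exact ⟨hx₀, le_rfl, hl₀, le_rfl⟩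
  | call _ _ hg ih =>
    obtain ⟨h1, h2, h3, h4⟩ := ih
    obtain ⟨g1, g2, g3, g4, -⟩ := hg.spec hP h1 h3
    exact ⟨g1, h2.trans g2, g3, g4.trans h4⟩

/-- Above ε only the relative gap test can have failed, and its failure rearranges to this. -/
theorem le_mul_of_not_aplGuard {η α ε : ℝ} {x : EuclideanSpace ℝ (Fin d)} {l : ℝ} (hα : 1 < α)
    (h : ¬ AplGuard P η α ε x l) (hε : ε < P.v x η) : P.v x η ≤ α * l := by
  have h1 : P.v x η - l ≤ (α - 1) / α * P.v x η := not_lt.1 fun H => h ⟨H, hε⟩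
  have h2 : α * (P.v x η - l) ≤ α * ((α - 1) / α * P.v x η) := by gcongr
  have h3 : α * ((α - 1) / α * P.v x η) = (α - 1) * P.v x η := by field_simp
  linarith

theorem InitPhase.spec (hP : P.Standing) {α ε : ℝ} (hα : 1 < α) (hε : 0 < ε)
    {x₀ : EuclideanSpace ℝ (Fin d)} {η₀ l₀ : ℝ} (hi : InitPhase P α ε x₀ η₀ l₀) :
    x₀ ∈ P.X ∧ 0 < l₀ ∧ l₀ ≤ P.V η₀ ∧ ε < P.v x₀ η₀ ∧ P.v x₀ η₀ ≤ α * l₀ := by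
  obtain ⟨xt, hxt, -, rfl, -, l, hl, ⟨n, hr, hng⟩, hu⟩ := hi
  have hlV : l ≤ P.V (P.f xt) :=
    hP.le_V_iff.2 fun x hx => (hl.2 ⟨x, hx, rfl⟩).trans (hP.vLin_le_v _ _ _)
  obtain ⟨h1, -, h3, -⟩ := hr.spec hP hxt hlV
  have h5 := le_mul_of_not_aplGuard hα hng hu
  exact ⟨h1, by nlinarith, h3, hu, h5⟩

/-- Properties of the states of the fixed-point loop. -/
structure LoopInvariant (P : Problem d m) (α β ε η₀ : ℝ) (s : LoopState d) : Prop where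
  x_mem : s.x ∈ P.X
  u_eq : s.u = P.v s.x s.η
  l_pos : 0 < s.l
  l_le : s.l ≤ P.V s.η
  u_le : ε < s.u → s.u ≤ α * s.l
  eta_le : η₀ ≤ s.η
  prev : 0 < s.t → 0 < s.lPrev ∧ P.V (s.η - β * s.lPrev) ≤ s.uPrev
  t_le : s.t * (β * ε) ≤ α * (s.η - η₀)

theorem LoopInvariant.nextLower_pos {α β ε η₀ : ℝ} (hβ1 : β < 1) {s : LoopState d}
    (hs : LoopInvariant P α β ε η₀ s) : 0 < s.nextLower β :=
  mul_pos (lt_of_lt_of_le (sub_pos.2 hβ1) (le_max_left _ _)) hs.l_pos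

/-- V falls at rate at most 1, so a step β l costs at most β l. -/
theorem LoopInvariant.one_sub_mul_le (hP : P.Standing) {α β ε η₀ : ℝ} (hβ : 0 < β)
    {s : LoopState d} (hs : LoopInvariant P α β ε η₀ s) :
    (1 - β) * s.l ≤ P.V (s.nextEta β) := by
  have h1 := hP.V_le_add (η := s.η) (η' := s.nextEta β)
    (le_add_of_nonneg_right (mul_pos hβ hs.l_pos).le)
  unfold LoopState.nextEta at *
  linarith [hs.l_le]

theorem LoopInvariant.nextLower_le (hP : P.Standing) {α β ε η₀ : ℝ} (hβ : 0 < β) (hβ1 : β < 1)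
    {s : LoopState d} (hs : LoopInvariant P α β ε η₀ s) :
    s.nextLower β ≤ P.V (s.nextEta β) := by
  have h1 := hs.one_sub_mul_le hP hβ
  rw [LoopState.nextLower, max_mul_of_nonneg _ _ hs.l_pos.le]
  refine max_le h1 ?_
  split_ifs with ht
  · obtain ⟨hp, hV⟩ := hs.prev (by omega)
    -- The last two steps are β times the lower bounds, so β cancels in the ratio of step lengths.
    have := hP.extrapolate_V (l := s.l) (b := β * s.l) (mul_pos hβ hp) (mul_pos hβ hs.l_pos) hV
      (by rw [sub_add_cancel]; exact hs.l_le)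
    rw [sub_add_cancel] at this
    refine le_trans (le_of_eq ?_) this
    field_simp
  · rw [zero_mul]
    exact (mul_pos (sub_pos.2 hβ1) hs.l_pos).le.trans h1

theorem LoopReach.invariant (hP : P.Standing) {α β ν ε : ℝ} (hα : 1 < α) (hβ : 0 < β)
    (hβ1 : β < 1) (hε : 0 < ε) {x₀ : EuclideanSpace ℝ (Fin d)} {η₀ l₀ : ℝ}
    (hi : InitPhase P α ε x₀ η₀ l₀) {s : LoopState d}
    (hr : LoopReach P α β ν ε x₀ η₀ l₀ s) : LoopInvariant P α β ε η₀ s := by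
  induction hr with
  | start =>
    obtain ⟨h1, h2, h3, h4, h5⟩ := hi.spec hP hα hε
    exact ⟨h1, rfl, h2, h3, fun _ => h5, le_rfl, fun h => absurd h (lt_irrefl _), by simp⟩
  | @stage s n x l _ hu hr ih =>
    obtain ⟨h1, h2, h3, -⟩ := hr.1.spec hP ih.x_mem (ih.nextLower_le hP hβ hβ1)
    have hl := mul_pos hβ ih.l_pos
    refine ⟨h1, rfl, (ih.nextLower_pos hβ1).trans_le h2, h3, le_mul_of_not_aplGuard hα hr.2,
      ih.eta_le.trans (le_add_of_nonneg_right hl.le), fun _ => ⟨ih.l_pos, ?_⟩, ?_⟩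
    · simp only [LoopState.nextEta, add_sub_cancel_right, ih.u_eq]
      exact hP.V_le ih.x_mem _
    · simp only [LoopState.nextEta]
      push_cast
      -- A stage begins only if ε < u ≤ α l, so η moves by β l > β ε / α.
      have := mul_lt_mul_of_pos_left (hu.trans_le (ih.u_le hu)) hβ
      linarith [ih.t_le]

theorem LoopInvariant.eta_lt_fStar (hP : P.Standing) {α β ε η₀ : ℝ} {s : LoopState d}
    (hs : LoopInvariant P α β ε η₀ s) : s.η < P.fStar :=
  hP.lt_fStar (hs.l_pos.trans_le hs.l_le)

theorem LoopReach.exists_stage_bound (hP : P.Standing) {α β ν ε : ℝ} (hα : 1 < α) (hβ : 0 < β)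
    (hβ1 : β < 1) (hε : 0 < ε) {x₀ : EuclideanSpace ℝ (Fin d)} {η₀ l₀ : ℝ}
    (hi : InitPhase P α ε x₀ η₀ l₀) :
    ∃ T : ℕ, ∀ s, LoopReach P α β ν ε x₀ η₀ l₀ s → s.t ≤ T := by
  refine ⟨⌈α * (P.fStar - η₀) / (β * ε)⌉₊, fun s hr => ?_⟩
  have hs := hr.invariant hP hα hβ hβ1 hε hi
  have : (s.t : ℝ) ≤ α * (P.fStar - η₀) / (β * ε) := by
    rw [le_div_iff₀ (mul_pos hβ hε)]
    have : α * (s.η - η₀) ≤ α * (P.fStar - η₀) := by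
      gcongr; exact (hs.eta_lt_fStar hP).le
    exact hs.t_le.trans this
  exact_mod_cast this.trans (Nat.le_ceil _)

/-- The subgradient inequality at the root gives -w (η* - η) ≤ V(η) ≤ u, and η < f* turns f(x) - η ≤
ε into near-optimality. -/
theorem LoopInvariant.quality (hP : P.Standing) {α β ε η₀ : ℝ} (hε : 0 < ε)
    {s : LoopState d} (hs : LoopInvariant P α β ε η₀ s) (hu : s.u ≤ ε) :
    (∀ w, IsSubgradient P.V P.etaStar w → w < 0 → P.etaStar - s.η ≤ ε / (-w)) ∧
      s.x ∈ P.X ∧ P.f s.x - P.fStar ≤ ε ∧ ‖fun i => max (P.g i s.x) 0‖ ≤ ε := by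
  rw [hs.u_eq] at hu
  refine ⟨fun w hw hw0 => ?_, hs.x_mem, ?_, ?_⟩
  · rw [le_div_iff₀ (neg_pos.2 hw0)]
    have h1 := hw s.η
    rw [hP.V_etaStar, zero_add] at h1
    have h2 : inner ℝ w (s.η - P.etaStar) = (s.η - P.etaStar) * w := rfl
    linarith [hP.V_le hs.x_mem s.η]
  · linarith [P.f_sub_le_v s.x s.η, hs.eta_lt_fStar hP]
  · refine (pi_norm_le_iff_of_nonneg hε.le).2 fun i => ?_
    rw [Real.norm_of_nonneg (le_max_right _ _)]
    exact max_le ((P.g_le_v s.x s.η i).trans hu) hε.le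

theorem LoopInvariant.wellPosed (hP : P.Standing) {α β ν ε η₀ : ℝ} (hβ : 0 < β)
    (hβ1 : β < 1) (hν : 1 / 2 < ν) {s : LoopState d}
    (hs : LoopInvariant P α β ε η₀ s) {n k : ℕ} {x : EuclideanSpace ℝ (Fin d)} {l : ℝ}
    {S : GapState d} (hc : LoopCall P α β ν ε s n x l)
    (hr : GapReach P x l (s.nextEta β) (2 * ν - 1) k S) :
    GapWellPosed P x l (s.nextEta β) (2 * ν - 1) k S := by
  obtain ⟨h1, -, h3, -⟩ := hc.2.1.spec hP hs.x_mem (hs.nextLower_le hP hβ hβ1)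
  exact (hr.invariant hP h1 h3).wellPosed hP (by linarith) (h3.trans (hP.V_le h1 _))

/-! ### The iteration bound for one gap reduction. -/

/-- Weighted AM-GM, used term by term in place of Hölder's inequality for the whole sum. The free
parameter A allows an induction with A fixed. -/
theorem rpow_mul_rpow_le_weighted {ρ K A D r : ℝ} (hρ : 0 ≤ ρ) (hρ1 : ρ ≤ 1) (hK : 0 ≤ K)
    (hA : 0 < A) (hD : 0 < D) (hr : 0 ≤ r) :
    K ^ (1 - ρ) * r ^ (1 + ρ) ≤ A ^ ((1 - ρ) / 2) * D ^ (1 + ρ) *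
      ((1 - ρ) / 2 * (K ^ 2 / A) + (1 + ρ) / 2 * (r ^ 2 / D ^ 2)) := by
  have h := Real.geom_mean_le_arith_mean2_weighted (w₁ := (1 - ρ) / 2) (w₂ := (1 + ρ) / 2)
    (p₁ := K ^ 2 / A) (p₂ := r ^ 2 / D ^ 2) (by linarith) (by linarith) (by positivity)
    (by positivity) (by ring)
  have hsq : ∀ (b w : ℝ), 0 ≤ b → (b ^ 2) ^ (w / 2) = b ^ w := fun b w hb => by
    rw [← Real.rpow_natCast_mul hb]; congr 1; push_cast; ring
  rw [Real.div_rpow (by positivity) hA.le, Real.div_rpow (by positivity) (by positivity),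
    hsq K _ hK, hsq r _ hr, hsq D _ hD.le] at h
  calc _ = A ^ ((1 - ρ) / 2) * D ^ (1 + ρ) *
        (K ^ (1 - ρ) / A ^ ((1 - ρ) / 2) * (r ^ (1 + ρ) / D ^ (1 + ρ))) := by
        field_simp
    _ ≤ _ := by gcongr

theorem weight_rpow_mul_le {ρ : ℝ} (hρ : 0 ≤ ρ) (k : ℕ) :
    weight (k + 1) ^ (1 + ρ) * (((k : ℝ) + 1) * (k + 2) / 2) ≤ 2 ^ ρ * ((k : ℝ) + 1) ^ (1 - ρ) := by
  have hk : (0 : ℝ) < (k : ℝ) + 1 := by positivity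
  have hw : weight (k + 1) = 2 / ((k : ℝ) + 2) := by
    unfold weight; push_cast; ring
  rw [hw, Real.rpow_add (by positivity), Real.rpow_one]
  have h1 : (2 / ((k : ℝ) + 2)) ^ ρ ≤ (2 / ((k : ℝ) + 1)) ^ ρ := by gcongr; norm_num
  calc _ = (2 / ((k : ℝ) + 2)) ^ ρ * ((k : ℝ) + 1) := by field_simp
    _ ≤ (2 / ((k : ℝ) + 1)) ^ ρ * ((k : ℝ) + 1) := by gcongr
    _ = _ := by
      rw [Real.div_rpow (by norm_num) hk.le, Real.rpow_sub hk, Real.rpow_one]; ring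

/-- The estimate of the trial value behind the convergence rate. -/
theorem v_gapTrial_sub_le (hP : P.Standing) {ρ Mbar : ℝ}
    {M : Fin (m + 1) → EuclideanSpace ℝ (Fin d) → EuclideanSpace ℝ (Fin d) → ℝ}
    (hM : P.HolderSmooth ρ M) (hρ : 0 ≤ ρ) (hb : ∀ i, ∀ y ∈ P.X, ∀ z ∈ P.X, M i y z ≤ Mbar)
    {x₀ x : EuclideanSpace ℝ (Fin d)} {l η : ℝ} {k : ℕ} {S : GapState d}
    (hS : GapInvariant P x₀ l η S) (hx : x ∈ gapXL P x₀ l η (k + 1) S) :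
    P.v (gapTrial (k + 1) S x) η - gapLevel P x₀ l η ≤
      (1 - weight (k + 1)) * (S.vU - gapLevel P x₀ l η) +
        Mbar / (1 + ρ) * (weight (k + 1) ^ (1 + ρ) * ‖x - S.x‖ ^ (1 + ρ)) := by
  have hxX := hS.loc_subset hx.1
  have ht := gapTrial_mem (k := k) hP hS.y_mem hxX
  have hz : gapZ (k + 1) S ∈ P.X := by
    have := gapTrial_mem (k := k) hP hS.y_mem (hS.loc_subset hS.x_mem)
    rwa [gapTrial, add_comm] at this
  have h1 := hM.v_le hρ (fun i => hb i _ ht _ hz) η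
  have hw := weight_succ_nonneg k
  -- The two points differ only in the prox center, which produces the factor `weight ^ (1 + ρ)` in
  -- the smoothness error.
  have e : gapTrial (k + 1) S x - gapZ (k + 1) S = weight (k + 1) • (x - S.x) := by
    simp only [gapTrial, gapZ, smul_sub]; abel
  rw [e, norm_smul, Real.norm_of_nonneg hw, Real.mul_rpow hw (norm_nonneg _)] at h1
  have h2 := (P.convexOn_vLin (gapZ (k + 1) S) η).2 (Set.mem_univ x) (Set.mem_univ S.y) hw
    (sub_nonneg.2 (weight_succ_le_one k)) (by ring)
  simp only [smul_eq_mul] at h2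
  have h3 := mul_le_mul_of_nonneg_left hx.2 hw
  have h4 := mul_le_mul_of_nonneg_left ((hP.vLin_le_v S.y (gapZ (k + 1) S) η).trans_eq hS.y_val)
    (sub_nonneg.2 (weight_succ_le_one k))
  unfold gapTrial at h1 ⊢
  linarith

/-- The recursion for the upper bound telescopes after multiplication by (k + 1)(k + 2) / 2. AM-GM
turns the smoothness errors into sums of (j + 1)² and of squared steps, and the squared steps
telescope too. -/
theorem GapReach.potential (hP : P.Standing) {ρ Mbar D : ℝ}
    {M : Fin (m + 1) → EuclideanSpace ℝ (Fin d) → EuclideanSpace ℝ (Fin d) → ℝ}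
    (hM : P.HolderSmooth ρ M) (hρ : 0 ≤ ρ) (hρ1 : ρ ≤ 1) (hMbar : 0 ≤ Mbar)
    (hb : ∀ i, ∀ y ∈ P.X, ∀ z ∈ P.X, M i y z ≤ Mbar) (hD : 0 < D)
    {x₀ : EuclideanSpace ℝ (Fin d)} {l η θ : ℝ} {k : ℕ} {S : GapState d}
    (hx₀ : x₀ ∈ P.X) (hl : l ≤ P.V η) {A : ℝ} (hA : 0 < A) (hr : GapReach P x₀ l η θ k S) :
    (S.vU - gapLevel P x₀ l η) * ((k : ℝ) * (k + 1) / 2) ≤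
      Mbar / (1 + ρ) * 2 ^ ρ * (A ^ ((1 - ρ) / 2) * D ^ (1 + ρ)) *
        ((1 - ρ) / 2 * ((k : ℝ) ^ 3 / A) + (1 + ρ) / 2 * (‖S.x - x₀‖ ^ 2 / D ^ 2)) := by
  induction hr with
  | start => simp [gapInit]
  | @step k S S' h hr hh _ hu _ ih =>
    have hS := hr.invariant hP hx₀ hl
    have h1 := v_gapTrial_sub_le hP hM hρ hb hS hu.x_mem
    have h2 : S'.vU ≤ P.v (gapTrial (k + 1) S S'.x) η := hu.vU_eq ▸ min_le_right _ _
    -- Obtuse angle: the localizer containing the new point lies in the half-space cut off at the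
    -- previous projection.
    have h3 : ‖S.x - x₀‖ ^ 2 + ‖S'.x - S.x‖ ^ 2 ≤ ‖S'.x - x₀‖ ^ 2 := by
      have := hS.inner_nonneg _ hu.x_mem.1
      rw [← sub_add_sub_cancel' S.x x₀ S'.x, norm_add_sq_real]
      linarith
    have h4 := rpow_mul_rpow_le_weighted (K := (k : ℝ) + 1) hρ hρ1 (by positivity) hA hD
      (norm_nonneg (S'.x - S.x))
    have h5 := weight_rpow_mul_le hρ k
    have hc : 0 ≤ Mbar / (1 + ρ) := by positivity
    have hw : (1 - weight (k + 1)) * (((k : ℝ) + 1) * (k + 2) / 2) = k * (k + 1) / 2 := by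
      unfold weight; push_cast; field_simp; ring
    have hq : 0 ≤ ((k : ℝ) + 1) * (k + 2) / 2 := by positivity
    push_cast
    calc (S'.vU - gapLevel P x₀ l η) * (((k : ℝ) + 1) * (k + 1 + 1) / 2)
        = (S'.vU - gapLevel P x₀ l η) * (((k : ℝ) + 1) * (k + 2) / 2) := by ring
      _ ≤ ((1 - weight (k + 1)) * (S.vU - gapLevel P x₀ l η) +
            Mbar / (1 + ρ) * (weight (k + 1) ^ (1 + ρ) * ‖S'.x - S.x‖ ^ (1 + ρ))) *
            (((k : ℝ) + 1) * (k + 2) / 2) := by gcongr; linarith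
      _ = (S.vU - gapLevel P x₀ l η) * (k * (k + 1) / 2) + Mbar / (1 + ρ) *
            ((weight (k + 1) ^ (1 + ρ) * (((k : ℝ) + 1) * (k + 2) / 2)) *
              ‖S'.x - S.x‖ ^ (1 + ρ)) := by rw [← hw]; ring
      _ ≤ (S.vU - gapLevel P x₀ l η) * (k * (k + 1) / 2) + Mbar / (1 + ρ) *
            ((2 ^ ρ * ((k : ℝ) + 1) ^ (1 - ρ)) * ‖S'.x - S.x‖ ^ (1 + ρ)) := by gcongr
      _ = (S.vU - gapLevel P x₀ l η) * (k * (k + 1) / 2) + Mbar / (1 + ρ) * 2 ^ ρ *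
            (((k : ℝ) + 1) ^ (1 - ρ) * ‖S'.x - S.x‖ ^ (1 + ρ)) := by ring
      _ ≤ Mbar / (1 + ρ) * 2 ^ ρ * (A ^ ((1 - ρ) / 2) * D ^ (1 + ρ)) *
            ((1 - ρ) / 2 * ((k : ℝ) ^ 3 / A) + (1 + ρ) / 2 * (‖S.x - x₀‖ ^ 2 / D ^ 2)) +
          Mbar / (1 + ρ) * 2 ^ ρ * (A ^ ((1 - ρ) / 2) * D ^ (1 + ρ) *
            ((1 - ρ) / 2 * (((k : ℝ) + 1) ^ 2 / A) +
              (1 + ρ) / 2 * (‖S'.x - S.x‖ ^ 2 / D ^ 2))) := by gcongr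
      _ = Mbar / (1 + ρ) * 2 ^ ρ * (A ^ ((1 - ρ) / 2) * D ^ (1 + ρ)) *
            ((1 - ρ) / 2 * (((k : ℝ) ^ 3 + (k + 1) ^ 2) / A) +
              (1 + ρ) / 2 * ((‖S.x - x₀‖ ^ 2 + ‖S'.x - S.x‖ ^ 2) / D ^ 2)) := by ring
      _ ≤ _ := by
        -- The sum of the squares up to k is dominated by k³.
        have h6 : (k : ℝ) ^ 3 + (k + 1) ^ 2 ≤ (k + 1) ^ 3 := by
          have : (0 : ℝ) ≤ k := by positivity
          nlinarith
        have h7 : 0 ≤ (1 - ρ) / 2 := by linarith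
        gcongr

/-- While the reduction runs, every trial value has failed the upper test, hence so has their
minimum. -/
theorem GapReach.le_vU_sub {x₀ : EuclideanSpace ℝ (Fin d)} {l η θ : ℝ} {k : ℕ} {S : GapState d}
    (hθ1 : θ ≤ 1) (hl : l ≤ P.v x₀ η) (hr : GapReach P x₀ l η θ k S) :
    θ * (P.v x₀ η - gapLevel P x₀ l η) ≤ S.vU - gapLevel P x₀ l η := by
  induction hr with
  | start =>
    have : 0 ≤ P.v x₀ η - gapLevel P x₀ l η := by unfold gapLevel; linarith
    simp only [gapInit]
    nlinarith
  | step _ _ _ hu hn ih =>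
    rw [hu.vU_eq, ← min_sub_sub_right]
    exact le_min ih (not_le.1 hn).le

/-- The number of iterations of a gap reduction. -/
theorem GapReach.iters_le (hP : P.Standing) {ρ Mbar D : ℝ}
    {M : Fin (m + 1) → EuclideanSpace ℝ (Fin d) → EuclideanSpace ℝ (Fin d) → ℝ}
    (hM : P.HolderSmooth ρ M) (hρ : 0 ≤ ρ) (hρ1 : ρ ≤ 1) (hMbar : 0 ≤ Mbar)
    (hb : ∀ i, ∀ y ∈ P.X, ∀ z ∈ P.X, M i y z ≤ Mbar) (hD : 0 < D) (hdiam : Metric.diam P.X ≤ D)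
    {x₀ : EuclideanSpace ℝ (Fin d)} {l η θ : ℝ} {k : ℕ} {S : GapState d} (hθ : 0 < θ)
    (hθ1 : θ ≤ 1) (hx₀ : x₀ ∈ P.X) (hl : l ≤ P.V η) (hlt : l < P.v x₀ η)
    (hr : GapReach P x₀ l η θ k S) :
    (k : ℝ) ≤ (4 * (Mbar / (1 + ρ) * 2 ^ ρ * D ^ (1 + ρ)) / θ / (P.v x₀ η - l)) ^
      (2 / (1 + 3 * ρ)) := by
  have hΔ : 0 < P.v x₀ η - l := sub_pos.2 hlt
  rcases Nat.eq_zero_or_pos k with rfl | hk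
  · rw [Nat.cast_zero]; positivity
  have hk : (0 : ℝ) < k := by exact_mod_cast hk
  -- With A = k³ and ‖x - x₀‖ ≤ D the bracket is a convex combination of numbers at most 1.
  have h1 := hr.potential hP hM hρ hρ1 hMbar hb hD hx₀ hl (A := (k : ℝ) ^ 3) (by positivity)
  have h2 := hr.le_vU_sub hθ1 hlt.le
  have h3 : P.v x₀ η - gapLevel P x₀ l η = (P.v x₀ η - l) / 2 := by unfold gapLevel; ring
  have hS := hr.invariant hP hx₀ hl
  have h4 : ‖S.x - x₀‖ ≤ D := by
    rw [← dist_eq_norm]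
    exact (Metric.dist_le_diam_of_mem hP.X_bounded (hS.loc_subset hS.x_mem) hx₀).trans hdiam
  have h5 : (1 - ρ) / 2 * ((k : ℝ) ^ 3 / (k : ℝ) ^ 3) + (1 + ρ) / 2 * (‖S.x - x₀‖ ^ 2 / D ^ 2)
      ≤ 1 := by
    have : ‖S.x - x₀‖ ^ 2 / D ^ 2 ≤ 1 := by
      rw [div_le_one (by positivity)]; gcongr
    rw [div_self (by positivity)]
    nlinarith
  have h6 : θ * ((P.v x₀ η - l) / 2) * ((k : ℝ) * k / 2) ≤
      Mbar / (1 + ρ) * 2 ^ ρ * (((k : ℝ) ^ 3) ^ ((1 - ρ) / 2) * D ^ (1 + ρ)) := by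
    calc _ ≤ (S.vU - gapLevel P x₀ l η) * ((k : ℝ) * (k + 1) / 2) := by
          have : 0 ≤ θ * ((P.v x₀ η - l) / 2) := by positivity
          rw [h3] at h2
          gcongr
          · exact this.trans h2
          · linarith
      _ ≤ _ := h1
      _ ≤ _ := mul_le_of_le_one_right (by positivity) h5
  have h7 : (k : ℝ) ^ ((1 + 3 * ρ) / 2) ≤
      4 * (Mbar / (1 + ρ) * 2 ^ ρ * D ^ (1 + ρ)) / θ / (P.v x₀ η - l) := by
    -- Exponent count: 2 - 3(1 - ρ)/2 = (1 + 3ρ)/2.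
    have e : (k : ℝ) ^ ((1 + 3 * ρ) / 2) * ((k : ℝ) ^ 3) ^ ((1 - ρ) / 2) = k * k := by
      rw [← Real.rpow_natCast_mul hk.le, ← Real.rpow_add hk, ← sq, ← Real.rpow_natCast]
      congr 1; push_cast; ring
    have hp : 0 < ((k : ℝ) ^ 3) ^ ((1 - ρ) / 2) := by positivity
    rw [le_div_iff₀ hΔ, le_div_iff₀ hθ]
    refine le_of_mul_le_mul_right ?_ hp
    calc _ = 4 * (θ * ((P.v x₀ η - l) / 2) *
          ((k : ℝ) ^ ((1 + 3 * ρ) / 2) * ((k : ℝ) ^ 3) ^ ((1 - ρ) / 2) / 2)) := by ring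
      _ ≤ 4 * (Mbar / (1 + ρ) * 2 ^ ρ * (((k : ℝ) ^ 3) ^ ((1 - ρ) / 2) * D ^ (1 + ρ))) := by
          rw [e]; gcongr
      _ = _ := by ring
  calc (k : ℝ) = ((k : ℝ) ^ ((1 + 3 * ρ) / 2)) ^ (2 / (1 + 3 * ρ)) := by
        rw [← Real.rpow_mul hk.le]
        have : (1 + 3 * ρ) / 2 * (2 / (1 + 3 * ρ)) = 1 := by field_simp
        rw [this, Real.rpow_one]
    _ ≤ _ := by gcongr

/-- Iterations of a call of the gap reduction made by APL, in terms of the optimal value `V η`. -/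
theorem GapReach.iters_le_of_aplGuard (hP : P.Standing) {ρ Mbar D B : ℝ}
    {M : Fin (m + 1) → EuclideanSpace ℝ (Fin d) → EuclideanSpace ℝ (Fin d) → ℝ}
    (hM : P.HolderSmooth ρ M) (hρ : 0 ≤ ρ) (hρ1 : ρ ≤ 1) (hMbar : 0 ≤ Mbar)
    (hb : ∀ i, ∀ y ∈ P.X, ∀ z ∈ P.X, M i y z ≤ Mbar) (hD : 0 < D) (hdiam : Metric.diam P.X ≤ D)
    {x₀ : EuclideanSpace ℝ (Fin d)} {l η θ α ε : ℝ} {k : ℕ} {S : GapState d} (hα : 1 < α)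
    (hθ : 0 < θ) (hθ1 : θ ≤ 1) (hx₀ : x₀ ∈ P.X) (hl : l ≤ P.V η) (hV : 0 < P.V η)
    (hB : P.V η ≤ B) (hg : AplGuard P η α ε x₀ l) (hr : GapReach P x₀ l η θ k S) :
    (k : ℝ) + 1 ≤ ((4 * (Mbar / (1 + ρ) * 2 ^ ρ * D ^ (1 + ρ)) / θ / ((α - 1) / α)) ^
      (2 / (1 + 3 * ρ)) + B ^ (2 / (1 + 3 * ρ))) * (P.V η)⁻¹ ^ (2 / (1 + 3 * ρ)) := by
  have hα0 : 0 < (α - 1) / α := div_pos (by linarith) (by linarith)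
  have hv := hP.V_le hx₀ η
  have hΔ : (α - 1) / α * P.V η ≤ P.v x₀ η - l := le_trans (by gcongr) hg.1.le
  have hVΔ : 0 < (α - 1) / α * P.V η := by positivity
  have h1 := hr.iters_le hP hM hρ hρ1 hMbar hb hD hdiam hθ hθ1 hx₀ hl (by linarith)
  have hB0 : 0 < B := hV.trans_le hB
  have hpos : 0 < P.v x₀ η - l := hVΔ.trans_le hΔ
  rw [add_mul, ← Real.mul_rpow (by positivity) (by positivity),
    ← Real.mul_rpow (by positivity) (by positivity)]
  -- The iteration still in progress is the summand 1, absorbed as 1 ≤ (B / V(η))^p; only here is B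
  -- needed.
  refine add_le_add (h1.trans ?_) (Real.one_le_rpow ?_ (by positivity))
  · rw [← div_eq_mul_inv, div_div _ ((α - 1) / α)]
    gcongr
  · rwa [← div_eq_mul_inv, one_le_div hV]

/-! ### Calls per stage, and summation over the stages. -/

/-- The number of calls made by APL is at most the number `K` of contractions by `(1 + θ) / 2` that
force its stopping test. -/
theorem AplReach.exists_calls (hP : P.Standing) {η θ α ε c : ℝ} {x₀ x : EuclideanSpace ℝ (Fin d)}
    {l₀ l : ℝ} {n K : ℕ} (hα : 1 < α) (hθ : 0 ≤ θ) (hθ1 : θ ≤ 1) (hx₀ : x₀ ∈ P.X)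
    (hl₀ : l₀ ≤ P.V η)
    (hK : ((1 + θ) / 2) ^ K * (P.v x₀ η - l₀) ≤ (α - 1) / α * P.V η)
    (hc : ∀ x l k S, x ∈ P.X → l ≤ P.V η → AplGuard P η α ε x l → GapReach P x l η θ k S →
      (k : ℝ) + 1 ≤ c)
    (hr : AplReach P η θ α ε x₀ l₀ n x l) :
    ∃ j : ℕ, (n : ℝ) ≤ j * c ∧ j ≤ K ∧ (AplGuard P η α ε x l → j < K) ∧
      P.v x η - l ≤ ((1 + θ) / 2) ^ j * (P.v x₀ η - l₀) := by
  have hgap : 0 ≤ P.v x₀ η - l₀ := sub_nonneg.2 (hl₀.trans (hP.V_le hx₀ η))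
  have hlt : ∀ {x : EuclideanSpace ℝ (Fin d)} {l : ℝ} {j : ℕ}, x ∈ P.X →
      P.v x η - l ≤ ((1 + θ) / 2) ^ j * (P.v x₀ η - l₀) → AplGuard P η α ε x l → j < K := by
    intro x l j hx hle hg
    -- After K contractions the gap is at most the fraction (α - 1) / α of V(η), hence of v(x, η),
    -- which contradicts the guard.
    by_contra! hj
    have h1 : ((1 + θ) / 2) ^ j ≤ ((1 + θ) / 2) ^ K :=
      pow_le_pow_of_le_one (by positivity) (by linarith) hj
    have h2 : (α - 1) / α * P.V η ≤ (α - 1) / α * P.v x η :=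
      mul_le_mul_of_nonneg_left (hP.V_le hx η) (div_nonneg (by linarith) (by linarith))
    linarith [hg.1, mul_le_mul_of_nonneg_right h1 hgap]
  induction hr with
  | start => exact ⟨0, by simp, Nat.zero_le _, hlt hx₀ (by simp), by simp⟩
  | @call n k x p l l' hr hg hret ih =>
    obtain ⟨j, h1, -, h3, h4⟩ := ih
    obtain ⟨hx, -, hl, -⟩ := hr.spec hP hx₀ hl₀
    obtain ⟨g1, -, -, -, g5⟩ := hret.spec hP hx hl
    have hk : (k : ℝ) ≤ c := by
      cases hret with
      | lower hS => exact_mod_cast hc _ _ _ _ hx hl hg hS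
      | upper hS => exact_mod_cast hc _ _ _ _ hx hl hg hS
    have h5 : P.v p η - l' ≤ ((1 + θ) / 2) ^ (j + 1) * (P.v x₀ η - l₀) := by
      refine g5.trans ?_
      rw [pow_succ', mul_assoc]
      gcongr
    refine ⟨j + 1, ?_, h3 hg, hlt g1 h5, h5⟩
    push_cast
    linarith

/-- Raising η does not raise v, so the new gap is at most u ≤ α l, and (1 - β) l is at most the new
optimal value. -/
theorem LoopInvariant.gap_le (hP : P.Standing) {α β ε η₀ : ℝ} (hα : 1 < α) (hβ : 0 < β)
    (hβ1 : β < 1) {s : LoopState d} (hs : LoopInvariant P α β ε η₀ s) (hu : ε < s.u) :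
    P.v s.x (s.nextEta β) - s.nextLower β ≤ α / (1 - β) * P.V (s.nextEta β) := by
  have h1 : P.v s.x (s.nextEta β) ≤ s.u := hs.u_eq ▸
    P.v_antitone s.x (le_add_of_nonneg_right (mul_pos hβ hs.l_pos).le)
  have h2 := hs.one_sub_mul_le hP hβ
  have hβ' : 0 < 1 - β := sub_pos.2 hβ1
  have h3 : s.l ≤ P.V (s.nextEta β) / (1 - β) := by rwa [le_div_iff₀' hβ']
  have h4 : α * s.l ≤ α * (P.V (s.nextEta β) / (1 - β)) := by gcongr
  rw [div_mul_eq_mul_div, ← mul_div_assoc] at *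
  linarith [hs.u_le hu, hs.nextLower_pos hβ1]

/-- The next level is a convex combination of η and the root f*, so convexity scales V by 1 - τ. The
Lagrangian error bound and V(η) ≤ α l bound τ from below. -/
theorem LoopInvariant.V_nextEta_le (hP : P.Standing) {α β ε η₀ : ℝ} (hα : 1 < α) (hβ : 0 < β)
    (hβ1 : β < 1) {s : LoopState d} (hs : LoopInvariant P α β ε η₀ s) (hu : ε < s.u)
    {y : Fin m → ℝ} (hy : P.IsLagrangeMultiplier y) :
    P.V (s.nextEta β) ≤ (1 - β / (α * (∑ i, |y i| + 1))) * P.V s.η := by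
  have hE : 0 < P.fStar - s.η := sub_pos.2 (hs.eta_lt_fStar hP)
  have hV : 0 < P.V s.η := hs.l_pos.trans_le hs.l_le
  have hV2 : 0 < P.V (s.nextEta β) := (hs.nextLower_pos hβ1).trans_le (hs.nextLower_le hP hβ hβ1)
  have hlt := hP.lt_fStar hV2
  have hl := hs.l_pos
  set τ := β * s.l / (P.fStar - s.η) with hτ
  have hτ0 : 0 ≤ τ := by positivity
  have hτ1 : τ ≤ 1 := by
    rw [hτ, div_le_one hE]; unfold LoopState.nextEta at hlt; linarith
  have h1 := hP.V_convexOn.2 (Set.mem_univ s.η) (Set.mem_univ P.fStar) (sub_nonneg.2 hτ1) hτ0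
    (by ring)
  have e : (1 - τ) • s.η + τ • P.fStar = s.nextEta β := by
    have : τ * (P.fStar - s.η) = β * s.l := by rw [hτ]; field_simp
    simp only [smul_eq_mul, LoopState.nextEta]; linarith
  rw [e, hP.V_fStar] at h1
  simp only [smul_eq_mul, mul_zero, add_zero] at h1
  refine h1.trans ?_
  gcongr
  have hY : 0 < ∑ i, |y i| + 1 := by positivity
  rw [hτ, div_le_div_iff₀ (by positivity) hE, mul_assoc]
  have h2 : P.V s.η ≤ α * s.l := ((hP.V_le hs.x_mem _).trans_eq hs.u_eq.symm).trans (hs.u_le hu)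
  have h3 : P.fStar - s.η ≤ (∑ i, |y i| + 1) * (α * s.l) :=
    (hP.fStar_sub_le hy s.η).trans (by gcongr)
  gcongr
  linarith

/-- A geometric decrease by the factor `1 - q` lets the powers `V ^ (-p)` accumulate to at most
`2 / q` times their last term. -/
theorem accumulate_rpow_inv {V₁ V₂ q p : ℝ} (hV₁ : 0 < V₁) (hV₂ : 0 < V₂) (hq : 0 < q)
    (hp : 1 / 2 ≤ p) (h : V₂ ≤ (1 - q) * V₁) :
    2 / q * V₁⁻¹ ^ p + V₂⁻¹ ^ p ≤ 2 / q * V₂⁻¹ ^ p := by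
  have hq1 : 0 < 1 - q := by
    by_contra! H
    nlinarith
  have h1 : V₁⁻¹ ≤ (1 - q) * V₂⁻¹ := by
    rw [← div_eq_mul_inv, inv_eq_one_div, div_le_div_iff₀ hV₁ hV₂]; linarith
  have h2 : V₁⁻¹ ^ p ≤ (1 - q) ^ p * V₂⁻¹ ^ p := by
    rw [← Real.mul_rpow hq1.le (by positivity)]
    gcongr
  -- The exponent p ≥ 1/2 enters through √(1 - q) ≤ 1 - q/2; this is the origin of the constant 2/q.
  have h3 : (1 - q) ^ p ≤ 1 - q / 2 := by
    calc (1 - q) ^ p ≤ (1 - q) ^ (1 / 2 : ℝ) :=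
          Real.rpow_le_rpow_of_exponent_ge hq1 (by linarith) hp
      _ = √(1 - q) := (Real.sqrt_eq_rpow _).symm
      _ ≤ 1 - q / 2 := Real.sqrt_le_iff.2 ⟨by linarith, by nlinarith⟩
  have h4 : 2 / q * V₁⁻¹ ^ p ≤ 2 / q * ((1 - q / 2) * V₂⁻¹ ^ p) := by
    gcongr
    exact h2.trans (by gcongr)
  have h5 : 2 / q * ((1 - q / 2) * V₂⁻¹ ^ p) = 2 / q * V₂⁻¹ ^ p - V₂⁻¹ ^ p := by
    field_simp
  linarith

/-- With zero multipliers the Lagrangian is f, so f* ≤ f(x̃⁰) = η₀, whereas V(η₀) > 0 forces η₀ <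
f*. -/
theorem InitPhase.multiplier_ne_zero (hP : P.Standing) {α ε : ℝ} (hα : 1 < α) (hε : 0 < ε)
    {x₀ : EuclideanSpace ℝ (Fin d)} {η₀ l₀ : ℝ} (hi : InitPhase P α ε x₀ η₀ l₀) {y : Fin m → ℝ}
    (hy : P.IsLagrangeMultiplier y) : y ≠ 0 := by
  rintro rfl
  obtain ⟨-, h1, h2, -⟩ := hi.spec hP hα hε
  obtain ⟨xt, hxt, -, rfl, -⟩ := hi
  have h3 := hy.fStar_le hxt
  simp only [Pi.zero_apply, zero_mul, Finset.sum_const_zero, add_zero] at h3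
  exact (hP.lt_fStar (h1.trans_le h2)).not_ge h3

/-- The iterations of one stage, together with those of the stages before it. -/
theorem stage_accumulate (hP : P.Standing) {α β ν ε η₀ p Kc : ℝ} (hα : 1 < α) (hβ : 0 < β)
    (hβ1 : β < 1) (hν : 1 / 2 < ν) (hν1 : ν < 1) (hp : 1 / 2 ≤ p) (hKc : 0 ≤ Kc) {K : ℕ}
    (hK : ν ^ K * (α / (1 - β)) ≤ (α - 1) / α) {s : LoopState d}
    (hs : LoopInvariant P α β ε η₀ s) (hu : ε < s.u) {y : Fin m → ℝ}
    (hy : P.IsLagrangeMultiplier y)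
    (hc : ∀ x l k S, x ∈ P.X → l ≤ P.V (s.nextEta β) → AplGuard P (s.nextEta β) α ε x l →
      GapReach P x l (s.nextEta β) (2 * ν - 1) k S →
        (k : ℝ) + 1 ≤ Kc * (P.V (s.nextEta β))⁻¹ ^ p)
    (hi : (s.iters : ℝ) ≤ K * Kc * (2 * α * (∑ i, |y i| + 1) / β * (P.V s.η)⁻¹ ^ p))
    {n : ℕ} {x : EuclideanSpace ℝ (Fin d)} {l : ℝ}
    (hr : AplReach P (s.nextEta β) (2 * ν - 1) α ε s.x (s.nextLower β) n x l) :
    (s.iters + n : ℝ) ≤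
        K * Kc * (2 * α * (∑ i, |y i| + 1) / β * (P.V (s.nextEta β))⁻¹ ^ p) ∧
      ∀ k S, AplGuard P (s.nextEta β) α ε x l →
        GapReach P x l (s.nextEta β) (2 * ν - 1) k S → (s.iters + n + (k + 1) : ℝ) ≤
          K * Kc * (2 * α * (∑ i, |y i| + 1) / β * (P.V (s.nextEta β))⁻¹ ^ p) := by
  have hV : 0 < P.V s.η := hs.l_pos.trans_le hs.l_le
  have hle := hs.nextLower_le hP hβ hβ1
  have hV2 : 0 < P.V (s.nextEta β) := (hs.nextLower_pos hβ1).trans_le hle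
  have hY : 0 < ∑ i, |y i| + 1 := by positivity
  have hacc := accumulate_rpow_inv (p := p) hV hV2 (by positivity) hp
    (hs.V_nextEta_le hP hα hβ hβ1 hu hy)
  have e : 2 / (β / (α * (∑ i, |y i| + 1))) = 2 * α * (∑ i, |y i| + 1) / β := by
    field_simp
  rw [e] at hacc
  have hacc := mul_le_mul_of_nonneg_left hacc (by positivity : 0 ≤ K * Kc)
  have hνe : (1 + (2 * ν - 1)) / 2 = ν := by ring
  obtain ⟨j, h1, h2, h3, -⟩ := hr.exists_calls (K := K) hP hα (by linarith) (by linarith) hs.x_mem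
    hle (by
      rw [hνe]
      calc _ ≤ ν ^ K * (α / (1 - β) * P.V (s.nextEta β)) := by
            gcongr; exact hs.gap_le hP hα hβ hβ1 hu
        _ = ν ^ K * (α / (1 - β)) * P.V (s.nextEta β) := by ring
        _ ≤ _ := by gcongr) hc
  have hc0 : 0 ≤ Kc * (P.V (s.nextEta β))⁻¹ ^ p := by positivity
  have hx := hr.spec hP hs.x_mem hle
  refine ⟨?_, fun k S hg hS => ?_⟩
  · have : (j : ℝ) ≤ K := by exact_mod_cast h2
    have := mul_le_mul_of_nonneg_right this hc0
    linarith
  -- The guard makes the number of completed calls strictly less than K, which leaves room for the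
  -- running one.
  · have h4 := hc x l k S hx.1 hx.2.2.1 hg hS
    have : ((j + 1 : ℕ) : ℝ) ≤ K := by exact_mod_cast h3 hg
    have := mul_le_mul_of_nonneg_right this hc0
    push_cast at this
    linarith

/-- The induction keeps the total below a multiple of the last term V(η)^(-p). The second claim
bounds that term: a stage begins only with l > ε / α, and the step retains at least (1 - β) l. -/
theorem LoopReach.iters_le (hP : P.Standing) {α β ν ε p Kc : ℝ} (hα : 1 < α) (hβ : 0 < β)
    (hβ1 : β < 1) (hν : 1 / 2 < ν) (hν1 : ν < 1) (hε : 0 < ε) (hp : 1 / 2 ≤ p) (hKc : 0 ≤ Kc)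
    {K : ℕ} (hK : ν ^ K * (α / (1 - β)) ≤ (α - 1) / α) {y : Fin m → ℝ}
    (hy : P.IsLagrangeMultiplier y) {x₀ : EuclideanSpace ℝ (Fin d)} {η₀ l₀ : ℝ}
    (hi : InitPhase P α ε x₀ η₀ l₀)
    (hc : ∀ η x l k S, η₀ ≤ η → 0 < P.V η → x ∈ P.X → l ≤ P.V η → AplGuard P η α ε x l →
      GapReach P x l η (2 * ν - 1) k S → (k : ℝ) + 1 ≤ Kc * (P.V η)⁻¹ ^ p)
    {s : LoopState d} (hr : LoopReach P α β ν ε x₀ η₀ l₀ s) :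
    (s.iters : ℝ) ≤ K * Kc * (2 * α * (∑ i, |y i| + 1) / β * (P.V s.η)⁻¹ ^ p) ∧
      (1 - β) * ε ≤ α * P.V s.η := by
  have hβ' : 0 < 1 - β := sub_pos.2 hβ1
  induction hr with
  | start =>
    obtain ⟨-, h2, h3, h4, h5⟩ := hi.spec hP hα hε
    have hV : 0 < P.V η₀ := h2.trans_le h3
    have h6 : α * l₀ ≤ α * P.V η₀ := by gcongr
    refine ⟨?_, by nlinarith⟩
    rw [Nat.cast_zero]
    positivity
  | @stage s n x l hr hu hret ih =>
    have hs := hr.invariant hP hα hβ hβ1 hε hi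
    have hη : η₀ ≤ s.nextEta β :=
      hs.eta_le.trans (le_add_of_nonneg_right (mul_pos hβ hs.l_pos).le)
    have hV2 : 0 < P.V (s.nextEta β) :=
      (hs.nextLower_pos hβ1).trans_le (hs.nextLower_le hP hβ hβ1)
    refine ⟨?_, ?_⟩
    · have := (stage_accumulate hP hα hβ hβ1 hν hν1 hp hKc hK hs hu hy
        (fun x l k S => hc _ x l k S hη hV2) ih.1 hret.1).1
      exact_mod_cast this
    · have h1 := hs.one_sub_mul_le hP hβ
      have h2 : (1 - β) * ε ≤ (1 - β) * (α * s.l) := by gcongr; exact (hu.trans_le (hs.u_le hu)).le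
      have h3 : α * ((1 - β) * s.l) ≤ α * P.V (s.nextEta β) := by gcongr
      change _ ≤ α * P.V (s.nextEta β)
      linarith

theorem LoopIters.exists_le (hP : P.Standing) {α β ν ε p Kc : ℝ} (hα : 1 < α) (hβ : 0 < β)
    (hβ1 : β < 1) (hν : 1 / 2 < ν) (hν1 : ν < 1) (hε : 0 < ε) (hp : 1 / 2 ≤ p) (hKc : 0 ≤ Kc)
    {K : ℕ} (hK : ν ^ K * (α / (1 - β)) ≤ (α - 1) / α) {y : Fin m → ℝ}
    (hy : P.IsLagrangeMultiplier y) {x₀ : EuclideanSpace ℝ (Fin d)} {η₀ l₀ : ℝ}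
    (hi : InitPhase P α ε x₀ η₀ l₀)
    (hc : ∀ η x l k S, η₀ ≤ η → 0 < P.V η → x ∈ P.X → l ≤ P.V η → AplGuard P η α ε x l →
      GapReach P x l η (2 * ν - 1) k S → (k : ℝ) + 1 ≤ Kc * (P.V η)⁻¹ ^ p)
    {N : ℕ} (hN : LoopIters P α β ν ε x₀ η₀ l₀ N) :
    (N : ℝ) ≤ K * Kc * (2 * α / β) * (α / (1 - β)) ^ p * (∑ i, |y i| + 1) * (1 / ε) ^ p := by
  have hβ' : 0 < 1 - β := sub_pos.2 hβ1
  have key : ∀ V : ℝ, (1 - β) * ε ≤ α * V →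
      K * Kc * (2 * α * (∑ i, |y i| + 1) / β * V⁻¹ ^ p) ≤
        K * Kc * (2 * α / β) * (α / (1 - β)) ^ p * (∑ i, |y i| + 1) * (1 / ε) ^ p := by
    intro V hV
    have hV0 : 0 < V := by
      have : 0 < α * V := lt_of_lt_of_le (by positivity) hV
      exact pos_of_mul_pos_right this (by linarith)
    have h1 : V⁻¹ ^ p ≤ (α / (1 - β)) ^ p * (1 / ε) ^ p := by
      rw [← Real.mul_rpow (by positivity) (by positivity)]
      gcongr
      rw [inv_eq_one_div, div_mul_div_comm, div_le_div_iff₀ hV0 (by positivity)]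
      linarith
    calc _ ≤ K * Kc * (2 * α * (∑ i, |y i| + 1) / β * ((α / (1 - β)) ^ p * (1 / ε) ^ p)) := by
          gcongr
      _ = _ := by ring
  cases hN with
  | between hr =>
    obtain ⟨h1, h2⟩ := hr.iters_le hP hα hβ hβ1 hν hν1 hε hp hKc hK hy hi hc
    exact h1.trans (key _ h2)
  | @running s n k x l S hr hcall hS =>
    obtain ⟨h1, -⟩ := hr.iters_le hP hα hβ hβ1 hν hν1 hε hp hKc hK hy hi hc
    have hs := hr.invariant hP hα hβ hβ1 hε hi
    have hη : η₀ ≤ s.nextEta β :=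
      hs.eta_le.trans (le_add_of_nonneg_right (mul_pos hβ hs.l_pos).le)
    have hV2 : 0 < P.V (s.nextEta β) :=
      (hs.nextLower_pos hβ1).trans_le (hs.nextLower_le hP hβ hβ1)
    obtain ⟨hu, hapl, hg⟩ := hcall
    have h3 := (stage_accumulate hP hα hβ hβ1 hν hν1 hp hKc hK hs hu hy
      (fun x l k S => hc _ x l k S hη hV2) h1 hapl).2 k S hg hS
    have h4 := hs.one_sub_mul_le hP hβ
    have h5 : (1 - β) * ε ≤ (1 - β) * (α * s.l) := by gcongr; exact (hu.trans_le (hs.u_le hu)).le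
    have h6 : α * ((1 - β) * s.l) ≤ α * P.V (s.nextEta β) := by gcongr
    push_cast
    exact h3.trans (key _ (by linarith))

/-- The coefficient of `(‖y‖₁ + 1) (1 / ε) ^ (2 / (1 + 3 ρ))` in the complexity bound, if stages make
at most `K` calls of the gap reduction. -/
def complexityConst (α β ν ρ Mbar D B : ℝ) (K : ℕ) : ℝ :=
  K * ((4 * (Mbar / (1 + ρ) * 2 ^ ρ * D ^ (1 + ρ)) / (2 * ν - 1) / ((α - 1) / α)) ^
    (2 / (1 + 3 * ρ)) + B ^ (2 / (1 + 3 * ρ))) * (2 * α / β) * (α / (1 - β)) ^ (2 / (1 + 3 * ρ))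

theorem complexityConst_nonneg {α β ν ρ Mbar D B : ℝ} (K : ℕ) (hα : 1 < α) (hβ : 0 < β)
    (hβ1 : β < 1) (hν : 1 / 2 < ν) (hρ : 0 ≤ ρ) (hMbar : 0 ≤ Mbar) (hD : 0 ≤ D) (hB : 0 ≤ B) :
    0 ≤ complexityConst α β ν ρ Mbar D B K := by
  have h1 : 0 < α - 1 := by linarith
  have h2 : 0 < 1 - β := by linarith
  have h3 : 0 < 2 * ν - 1 := by linarith
  unfold complexityConst
  positivity

theorem LoopIters.le_complexityConst (hP : P.Standing) {α β ν ε ρ Mbar D B : ℝ} (hα : 1 < α)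
    (hβ : 0 < β) (hβ1 : β < 1) (hν : 1 / 2 < ν) (hν1 : ν < 1) (hε : 0 < ε) (hρ : 0 ≤ ρ)
    (hρ1 : ρ ≤ 1) {M : Fin (m + 1) → EuclideanSpace ℝ (Fin d) → EuclideanSpace ℝ (Fin d) → ℝ}
    (hM : P.HolderSmooth ρ M) (hMbar : 0 ≤ Mbar)
    (hb : ∀ i, ∀ y ∈ P.X, ∀ z ∈ P.X, M i y z ≤ Mbar) (hD : 0 < D) (hdiam : Metric.diam P.X ≤ D)
    (hB : 0 ≤ B) {K : ℕ} (hK : ν ^ K * (α / (1 - β)) ≤ (α - 1) / α) {y : Fin m → ℝ}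
    (hy : P.IsLagrangeMultiplier y) {x₀ : EuclideanSpace ℝ (Fin d)} {η₀ l₀ : ℝ}
    (hi : InitPhase P α ε x₀ η₀ l₀) (hV : P.V η₀ ≤ B) {N : ℕ}
    (hN : LoopIters P α β ν ε x₀ η₀ l₀ N) :
    (N : ℝ) ≤ complexityConst α β ν ρ Mbar D B K * (∑ i, |y i| + 1) *
      (1 / ε) ^ (2 / (1 + 3 * ρ)) := by
  have h1 : 0 < α - 1 := by linarith
  have h3 : 0 < 2 * ν - 1 := by linarith
  refine hN.exists_le hP hα hβ hβ1 hν hν1 hε ?_ (by positivity) hK hy hi ?_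
  · rw [div_le_div_iff₀ (by norm_num) (by positivity)]
    linarith
  · intro η x l k S hη hVη hx hl hg hS
    exact hS.iters_le_of_aplGuard hP hM hρ hρ1 hMbar hb hD hdiam hα h3 (by linarith) hx hl hVη
      ((hP.V_antitone hη).trans hV) hg

theorem exists_pow_mul_le {α β ν : ℝ} (hα : 1 < α) (hβ1 : β < 1) (hν1 : ν < 1) :
    ∃ K : ℕ, ν ^ K * (α / (1 - β)) ≤ (α - 1) / α := by
  have h2 : 0 < α / (1 - β) := div_pos (by linarith) (by linarith)
  have h3 : 0 < (α - 1) / α := div_pos (by linarith) (by linarith)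
  obtain ⟨K, hK⟩ := exists_pow_lt_of_lt_one (div_pos h3 h2) hν1
  exact ⟨K, ((lt_div_iff₀ h2).1 hK).le⟩

end LevelSet

end

/-! ### Choice of the constants and the logarithmic factors. -/

open LevelSet in
theorem mainTheorem2 :
    -- validity of the lower bounds, well-posedness, termination, and quality of the output
    (∀ (d m : ℕ) (P : Problem d m), P.Standing →
      ∀ α β ν ε : ℝ, 1 < α → 0 < β → β < 1 → 1 / 2 < ν → ν < 1 → 0 < ε →
      ∀ (x₀ : EuclideanSpace ℝ (Fin d)) (η₀ l₀ : ℝ), InitPhase P α ε x₀ η₀ l₀ →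
        (∀ s, LoopReach P α β ν ε x₀ η₀ l₀ s → ε < s.u →
          0 < s.nextLower β ∧ s.nextLower β ≤ P.V (s.nextEta β) ∧
          ∀ n x l, LoopCall P α β ν ε s n x l →
            ∀ k S, GapReach P x l (s.nextEta β) (2 * ν - 1) k S →
              GapWellPosed P x l (s.nextEta β) (2 * ν - 1) k S) ∧
        (∃ T : ℕ, ∀ s, LoopReach P α β ν ε x₀ η₀ l₀ s → s.t ≤ T) ∧
        (∀ s, LoopReach P α β ν ε x₀ η₀ l₀ s → 0 < s.t → s.u ≤ ε →
          (∀ w, IsSubgradient P.V P.etaStar w → w < 0 → P.etaStar - s.η ≤ ε / (-w)) ∧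
          s.x ∈ P.X ∧ P.f s.x - P.fStar ≤ ε ∧ ‖fun i => max (P.g i s.x) 0‖ ≤ ε)) ∧
    -- complexity
    (∀ α β ν ρ Mbar D B : ℝ,
      1 < α → 0 < β → β < 1 → 1 / 2 < ν → ν < 1 → 0 ≤ ρ → ρ ≤ 1 →
      ∃ (C : ℝ) (C' : ℝ → ℝ), ∀ (d m : ℕ) (P : Problem d m), P.Standing →
        ∀ M : Fin (m + 1) → EuclideanSpace ℝ (Fin d) → EuclideanSpace ℝ (Fin d) → ℝ,
        P.HolderSmooth ρ M → (∀ i, ∀ y ∈ P.X, ∀ z ∈ P.X, M i y z ≤ Mbar) →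
        Metric.diam P.X ≤ D →
        ∀ ε : ℝ, 0 < ε →
        ∀ (x₀ : EuclideanSpace ℝ (Fin d)) (η₀ l₀ : ℝ), InitPhase P α ε x₀ η₀ l₀ → P.V η₀ ≤ B →
        ∀ y : Fin m → ℝ, P.IsLagrangeMultiplier y →
        ∀ N : ℕ, LoopIters P α β ν ε x₀ η₀ l₀ N →
          (N : ℝ) ≤ C * (((∑ i, |y i|) + 1) * (1 + Real.log ((∑ i, |y i|) + 1))) *
            (1 / ε) ^ (2 / (1 + 3 * ρ)) ∧
          ∀ κ : ℝ, 0 < κ → (y = 0 ∨ κ ≤ ∑ i, |y i|) →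
            (N : ℝ) ≤ C' κ * (((∑ i, |y i|) + 1) * Real.log ((∑ i, |y i|) + 1)) *
              (1 / ε) ^ (2 / (1 + 3 * ρ))) := by
  refine ⟨?_, ?_⟩
  · intro d m P hP α β ν ε hα hβ hβ1 hν _ hε x₀ η₀ l₀ hi
    refine ⟨fun s hr _ => ?_, LoopReach.exists_stage_bound hP hα hβ hβ1 hε hi,
      fun s hr _ hu => (hr.invariant hP hα hβ hβ1 hε hi).quality hP hε hu⟩
    have hs := hr.invariant hP hα hβ hβ1 hε hi
    exact ⟨hs.nextLower_pos hβ1, hs.nextLower_le hP hβ hβ1,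
      fun _ _ _ hc _ _ hS => hs.wellPosed hP hβ hβ1 hν hc hS⟩
  · intro α β ν ρ Mbar D B hα hβ hβ1 hν hν1 hρ hρ1
    obtain ⟨K, hK⟩ := exists_pow_mul_le (α := α) (β := β) (ν := ν) hα hβ1 hν1
    -- The constants are chosen before the problem, so the signs of the given bounds are unknown; D
    -- may also be 0, while the rate estimate divides by it.
    have hM0 : 0 ≤ max Mbar 0 := le_max_right _ _
    have hD0 : 0 < max D 1 := lt_max_of_lt_right one_pos
    have hB0 : 0 ≤ max B 0 := le_max_right _ _
    set C := complexityConst α β ν ρ (max Mbar 0) (max D 1) (max B 0) K with hC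
    have hC0 : 0 ≤ C := complexityConst_nonneg K hα hβ hβ1 hν hρ hM0 hD0.le hB0
    refine ⟨C, fun κ => C / Real.log (κ + 1), ?_⟩
    intro d m P hP M hM hb hdiam ε hε x₀ η₀ l₀ hi hV y hy N hN
    have hmain := hN.le_complexityConst hP hα hβ hβ1 hν hν1 hε hρ hρ1 hM hM0
      (fun i y hy z hz => (hb i y hy z hz).trans (le_max_left _ _)) hD0
      (hdiam.trans (le_max_left _ _)) hB0 hK hy hi (hV.trans (le_max_left _ _))
    rw [← hC] at hmain
    have hY0 : 0 ≤ ∑ i, |y i| := Finset.sum_nonneg fun _ _ => abs_nonneg _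
    set Y := ∑ i, |y i|
    refine ⟨hmain.trans ?_, fun κ hκ hor => hmain.trans ?_⟩
    · gcongr
      exact le_mul_of_one_le_right (by positivity)
        (le_add_of_nonneg_right (Real.log_nonneg (by linarith)))
    -- Zero multipliers cannot occur once the loop is entered, so log(Y + 1) is at least the
    -- positive number log(κ + 1), by which the constant was divided.
    · have hκY : κ ≤ Y := hor.resolve_left (hi.multiplier_ne_zero hP hα hε hy)
      have hlog : 0 < Real.log (κ + 1) := Real.log_pos (by linarith)
      refine mul_le_mul_of_nonneg_right ?_ (by positivity)
      calc C * (Y + 1) = C / Real.log (κ + 1) * ((Y + 1) * Real.log (κ + 1)) := by field_simp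
        _ ≤ C / Real.log (κ + 1) * ((Y + 1) * Real.log (Y + 1)) := by gcongr
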